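/- **Setting.** For an integer $N\ge 1$, $\alpha\in(0,1)$, an integer $b\ge 2$ and a constant $\epsilon>0$ (not depending on $N$), consider $N$ servers with exponential service rates $\mu_1\ge\mu_2\ge\dots\ge\mu_N\ge\epsilon$, normalized by $\sum_{n=1}^N\mu_n=N$. Jobs arrive in a Poisson process of rate $\lambda N$ with $\lambda=1-N^{-\alpha}$. Each server serves its queue in FIFO order and holds at most $b$ jobs (one in service and $b-1$ waiting). Under Join-the-Fastest-Shortest-Queue (JFSQ) an arriving job is routed to a server with the smallest number of jobs; among those to one with the largest service rate; remaining ties are broken uniformly at random. A job routed to a server with $b$ jobs is blocked (lost). Assume that there is an index $N_2$ with $\sum_{n=1}^{N_2}\mu_n=\lambda N$. Let $p_{\mathcal W}$ be the steady-state probability that an arriving job is routed to a busy server, $p_{\mathcal B}$ the steady-state probability that it is blocked, and $W$ the steady-state waiting time (before service starts) of a job that is not blocked. Fix $r>0$ and put $$k_{sub}=\frac{16(b-1)\mu_{N_2}}{\epsilon^2},\qquad k_{super}=\frac{24\,r\,(b-1)\mu_1}{\epsilon}.$$ *Sub-Halfin–Whitt condition:* $\alpha\in(0,\tfrac12)$ and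 $$\max\Big\{\frac{2(r+1)}{\log N},\ \frac{27(r+1)\,b\log N}{N^{1/4-\alpha/2}}\Big\}\le\epsilon\le\frac12,\qquad \frac{\mu_1}{\epsilon^2}\le\frac{N^{1-\alpha}}{64\,b\,(2\log^2N+3)}.$$ *Super-Halfin–Whitt condition:* $\alpha\in[\tfrac12,1)$ and $$\frac{\mu_1}{\epsilon}\le\frac{N^{1-\alpha}}{24\,r\,b\log^2N}.$$ **Theorem.** For every $r>0$ there is a constant $C>0$, depending only on $r$, such that for all $\alpha\in(0,1)$, $b\ge2$ and $\epsilon>0$ there is $N_0$ such that for all $N\ge N_0$, all service rates $\mu_1,\dots,\mu_N$ as above and every stationary distribution of the JFSQ queue-length Markov chain the following holds. 1) If the Sub-Halfin–Whitt condition holds, then $p_{\mathcal B}<1$, $W$ is integrable, and $$\mathbb E[W]\le C\Big(\frac1{N^\alpha}+\frac{k_{sub}}{N^{1-\alpha}}\Big),\qquad p_{\mathcal W}\le C\Big(\frac{k_{sub}}{N^{1-\alpha}}+\frac{\log N}{\sqrt N}\Big).$$ 2) If the Super-Halfin–Whitt condition holds, then $p_{\mathcal B}<1$, $W$ is integrable,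 and $$\mathbb E[W]\le C\Big(\frac{k_{super}\log N}{N^{1-\alpha}}+\frac{\log N}{\sqrt N}\Big),\qquad p_{\mathcal W}\le C\,\frac{k_{super}\log N}{N^{1-\alpha}}.$$ -/

import Mathlib

open MeasureTheory ProbabilityTheory

noncomputable section

namespace JFSQ

/-- Queue-length vectors `(q_1, …, q_N)`; `q n` counts all jobs at server `n`, including the one in
service, and is at most `b` (one job in service and `b - 1` waiting places). -/
abbrev State (N b : ℕ) : Type := Fin N → Fin (b + 1)

variable {N b : ℕ}

/-- The load `λ = 1 - N ^ (-α)`. -/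
def load (N : ℕ) (α : ℝ) : ℝ := 1 - (N : ℝ) ^ (-α)

/-- The servers with the shortest queue. -/
def shortest (q : State N b) : Finset (Fin N) :=
  Finset.univ.filter fun n => ∀ m, q n ≤ q m

/-- The fastest servers among those with the shortest queue. -/
def targets (μ : Fin N → ℝ) (q : State N b) : Finset (Fin N) :=
  (shortest q).filter fun n => ∀ m ∈ shortest q, μ m ≤ μ n

/-- The probability that Join-the-Fastest-Shortest-Queue routes a job arriving in state `q` to
server `n`: uniform over the fastest of the servers with the shortest queue. -/
def route (μ : Fin N → ℝ) (q : State N b) (n : Fin N) : ℝ :=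
  if n ∈ targets μ q then ((targets μ q).card : ℝ)⁻¹ else 0

/-- The state after an arrival routed to server `n`; the job is discarded if that server already
holds `b` jobs. -/
def arrive (q : State N b) (n : Fin N) : State N b :=
  if h : (q n : ℕ) < b then Function.update q n ⟨(q n : ℕ) + 1, Nat.succ_lt_succ h⟩ else q

/-- The state after a service completion at server `n`; nothing happens if server `n` is idle. -/
def depart (q : State N b) (n : Fin N) : State N b :=
  Function.update q n ⟨(q n : ℕ) - 1, lt_of_le_of_lt (Nat.sub_le _ _) (q n).isLt⟩

/-- The generator of the queue-length Markov chain under JFSQ, with Poisson arrivals of rate `λ N`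
and exponential service of rate `μ n` at each server `n`. -/
def generator (α : ℝ) (μ : Fin N → ℝ) (f : State N b → ℝ) (q : State N b) : ℝ :=
  (∑ n, load N α * N * route μ q n * (f (arrive q n) - f q)) +
    ∑ n, (if 1 ≤ (q n : ℕ) then μ n else 0) * (f (depart q n) - f q)

/-- `π` is a stationary distribution of the queue-length Markov chain under JFSQ. -/
structure IsStationary (α : ℝ) (μ : Fin N → ℝ) (π : State N b → ℝ) : Prop where
  nonneg : ∀ q, 0 ≤ π q
  sum_eq_one : ∑ q, π q = 1
  balance : ∀ f : State N b → ℝ, ∑ q, π q * generator α μ f q = 0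

/-- The probability that a job arriving in steady state is routed to a busy server. -/
def waitProb (μ : Fin N → ℝ) (π : State N b → ℝ) : ℝ :=
  ∑ q, ∑ n, if 1 ≤ (q n : ℕ) then π q * route μ q n else 0

/-- The probability that a job arriving in steady state is blocked, i.e. routed to a server that
holds `b` jobs. -/
def blockProb (μ : Fin N → ℝ) (π : State N b → ℝ) : ℝ :=
  ∑ q, ∑ n, if (q n : ℕ) = b then π q * route μ q n else 0

/-- The law of the sum of `k` independent exponential times of rate `ρ`. -/
def erlang (k : ℕ) (ρ : ℝ) : Measure ℝ :=
  (Measure.pi fun _ : Fin k => expMeasure ρ).map fun s => ∑ i, s i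

/-- The law of the waiting time (in the buffer, before service starts) of a job that arrives in
steady state, conditioned on not being blocked. A job that joins server `n` behind `k` jobs waits,
under FIFO, for one residual and `k - 1` full service times, which by memorylessness are `k`
independent exponential times of rate `μ n`. -/
def waitLaw (μ : Fin N → ℝ) (π : State N b → ℝ) : Measure ℝ :=
  ∑ q, ∑ n, if (q n : ℕ) < b then
    ENNReal.ofReal (π q * route μ q n / (1 - blockProb μ π)) • erlang (q n : ℕ) (μ n) else 0

/-- Normalized, decreasingly ordered service rates, bounded below by `ε`, such that the fastest
servers up to and including `n₂` have total capacity exactly `λ N`. -/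
structure Rates (α ε : ℝ) (μ : Fin N → ℝ) (n₂ : Fin N) : Prop where
  antitone : Antitone μ
  lower : ∀ n, ε ≤ μ n
  total : ∑ n, μ n = N
  critical : ∑ n ∈ Finset.Iic n₂, μ n = load N α * N

/-- The condition on the system in the Sub-Halfin–Whitt regime; `μ₁` is the largest rate. -/
structure SubAssumption (N b : ℕ) (α r ε μ₁ : ℝ) : Prop where
  regime : 0 < α ∧ α < 1 / 2
  lower : max (2 * (r + 1) / Real.log N)
    (27 * (r + 1) * b * Real.log N / (N : ℝ) ^ (1 / 4 - α / 2 : ℝ)) ≤ ε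
  upper : ε ≤ 1 / 2
  fastest : μ₁ / ε ^ 2 ≤ (N : ℝ) ^ (1 - α) / (64 * b * (2 * Real.log N ^ 2 + 3))

/-- The condition on the system in the Super-Halfin–Whitt regime; `μ₁` is the largest rate. -/
structure SuperAssumption (N b : ℕ) (α r ε μ₁ : ℝ) : Prop where
  regime : 1 / 2 ≤ α ∧ α < 1
  fastest : μ₁ / ε ≤ (N : ℝ) ^ (1 - α) / (24 * r * b * Real.log N ^ 2)

/-- The heterogeneity parameter of the Sub-Halfin–Whitt regime; `m` is the rate of the critical
server. -/
def kSub (b : ℕ) (ε m : ℝ) : ℝ := 16 * ((b : ℝ) - 1) * m / ε ^ 2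

/-- The heterogeneity parameter of the Super-Halfin–Whitt regime; `m` is the largest rate. -/
def kSuper (b : ℕ) (r ε m : ℝ) : ℝ := 24 * r * ((b : ℝ) - 1) * m / ε

end JFSQ

end

/-! Write I, Y and Z for `idle Finset.univ`, `waiting` and `idleRate`, and D = N - λN = N^(1-α).
Under JFSQ a job meets a busy server only when I = 0, so p_W = P(I = 0). A full server is busy,
hence p_B ≤ p_W, and once p_B ≤ 1/2 the mean wait is at most (2b/ε) p_W. Everything reduces to p_W.
Since N₀ may depend on α, b, ε and r, the constants in these parameters are absorbed for large N,
and C = 1 works.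

In stationarity the generator of every function has mean zero, so any pointwise upper bound for a
drift has nonnegative mean. Heterogeneity matters because Z may be far larger than I. The remedy is
the set `fast μ` of servers of rate above 2: normalization and the lower bound ε keep their total
rate below λN by at least εN/4, while every arrival goes to them as long as one is idle. Their idle
number I_F is therefore small (`expect_exp_idle_fast_le`), and Z ≤ 2I + μ₁ I_F.

For α < 1/2, the function θY + exp(-θI) yields E[exp(-θI)(Z - 3D/4)] ≥ 0. The event I = 0
contributes -(3/4) D p_W; a positive contribution needs I ≥ D/4, which costs exp(-D²/(32N)) with
D²/N = N^(1-2α) → ∞, or I_F ≥ D/(4μ₁), which is exponentially rare (`waitProb_mul_le_exp`).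

For α ≥ 1/2 one has D² ≤ N instead, and polynomial test functions bound D E[Y] by 12bN/ε²
(`expect_waiting_le`). The balance of waiting jobs then gives λN p_W ≤ 2μ₁ E[Y]
(`load_mul_waitProb_le`). -/

noncomputable section

namespace JFSQ

/-! ### Idle servers, waiting jobs, routing and general drift bounds -/

section

variable {N b : ℕ}

/-- The number of idle servers in `F`. -/
def idle (F : Finset (Fin N)) (q : State N b) : ℝ := ∑ n ∈ F, if (q n : ℕ) = 0 then 1 else 0

/-- The number of jobs in the buffers. -/
def waiting (q : State N b) : ℝ := ∑ n, (((q n : ℕ) - 1 : ℕ) : ℝ)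

/-- The total rate of the idle servers. -/
def idleRate (μ : Fin N → ℝ) (q : State N b) : ℝ := ∑ n, if (q n : ℕ) = 0 then μ n else 0

/-- The total rate of the servers in `F` that hold exactly one job. -/
def singleRate (μ : Fin N → ℝ) (F : Finset (Fin N)) (q : State N b) : ℝ :=
  ∑ n ∈ F, if (q n : ℕ) = 1 then μ n else 0

/-- The total rate of the servers that hold at least two jobs. -/
def queueRate (μ : Fin N → ℝ) (q : State N b) : ℝ := ∑ n, if 2 ≤ (q n : ℕ) then μ n else 0

/-- The servers of rate more than `2`. -/
def fast (μ : Fin N → ℝ) : Finset (Fin N) := Finset.univ.filter fun n => 2 < μ n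

theorem sum_update (φ : Fin N → Fin (b + 1) → ℝ) (F : Finset (Fin N)) (q : State N b) (n : Fin N)
    (v : Fin (b + 1)) :
    ∑ m ∈ F, φ m (Function.update q n v m) =
      ∑ m ∈ F, φ m (q m) + if n ∈ F then φ n v - φ n (q n) else 0 := by
  rw [← sub_eq_iff_eq_add', ← Finset.sum_sub_distrib]
  rw [← Finset.sum_ite_eq' F n fun m => φ m v - φ m (q m)]
  refine Finset.sum_congr rfl fun m _ => ?_
  by_cases h : m = n
  · subst h; simp
  · simp [h]

theorem idle_arrive (hb : 1 ≤ b) (F : Finset (Fin N)) (q : State N b) (n : Fin N) :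
    idle F (arrive q n) = idle F q - if n ∈ F ∧ (q n : ℕ) = 0 then 1 else 0 := by
  unfold arrive
  split_ifs with h h0 h0
  · have := sum_update (fun _ k => if (k : ℕ) = 0 then (1 : ℝ) else 0) F q n
      ⟨(q n : ℕ) + 1, Nat.succ_lt_succ h⟩
    simp only [idle] at *
    rw [this]; simp [h0.1, h0.2]; ring
  · have := sum_update (fun _ k => if (k : ℕ) = 0 then (1 : ℝ) else 0) F q n
      ⟨(q n : ℕ) + 1, Nat.succ_lt_succ h⟩
    simp only [idle] at *
    rw [this]
    by_cases hF : n ∈ F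
    · have : (q n : ℕ) ≠ 0 := fun h' => h0 ⟨hF, h'⟩
      simp [hF, this]
    · simp [hF]
  · omega
  · simp

theorem waiting_arrive (q : State N b) (n : Fin N) :
    waiting (arrive q n) = waiting q + if 1 ≤ (q n : ℕ) ∧ (q n : ℕ) < b then 1 else 0 := by
  unfold arrive
  split_ifs with h h0 h0
  · have := sum_update (fun _ k => (((k : ℕ) - 1 : ℕ) : ℝ)) Finset.univ q n
      ⟨(q n : ℕ) + 1, Nat.succ_lt_succ h⟩
    simp only [waiting] at *
    rw [this]
    simp [Nat.cast_sub h0.1]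
  · have := sum_update (fun _ k => (((k : ℕ) - 1 : ℕ) : ℝ)) Finset.univ q n
      ⟨(q n : ℕ) + 1, Nat.succ_lt_succ h⟩
    simp only [waiting] at *
    rw [this]
    have : (q n : ℕ) = 0 := by omega
    simp [this]
  · omega
  · simp

theorem idle_depart (F : Finset (Fin N)) (q : State N b) (n : Fin N) (hn : 1 ≤ (q n : ℕ)) :
    idle F (depart q n) = idle F q + if n ∈ F ∧ (q n : ℕ) = 1 then 1 else 0 := by
  refine (sum_update (fun _ k => if (k : ℕ) = 0 then (1 : ℝ) else 0) F q n
    ⟨(q n : ℕ) - 1, lt_of_le_of_lt (Nat.sub_le _ _) (q n).isLt⟩ :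
    idle F (depart q n) = _).trans ?_
  have h0 : (q n : ℕ) ≠ 0 := by omega
  have h1 : (q n : ℕ) - 1 = 0 ↔ (q n : ℕ) = 1 := by omega
  by_cases hF : n ∈ F <;> simp [idle, hF, h0, h1]

theorem waiting_depart (q : State N b) (n : Fin N) :
    waiting (depart q n) = waiting q - if 2 ≤ (q n : ℕ) then 1 else 0 := by
  refine (sum_update (fun _ k => (((k : ℕ) - 1 : ℕ) : ℝ)) Finset.univ q n
    ⟨(q n : ℕ) - 1, lt_of_le_of_lt (Nat.sub_le _ _) (q n).isLt⟩ :
    waiting (depart q n) = _).trans ?_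
  simp only [waiting, Finset.mem_univ, if_true, sub_eq_add_neg, add_right_inj]
  split_ifs with h
  · obtain ⟨k, hk⟩ := Nat.exists_eq_add_of_le h
    have h1 : (q n : ℕ) - 1 = k + 1 := by omega
    simp [h1]
  · have h1 : (q n : ℕ) - 1 = 0 := by omega
    simp [h1]

theorem idle_nonneg (F : Finset (Fin N)) (q : State N b) : 0 ≤ idle F q :=
  Finset.sum_nonneg fun _ _ => by split_ifs <;> norm_num

theorem waiting_nonneg (q : State N b) : 0 ≤ waiting q :=
  Finset.sum_nonneg fun _ _ => Nat.cast_nonneg _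

theorem idle_eq_card (F : Finset (Fin N)) (q : State N b) :
    idle F q = ((F.filter fun n => (q n : ℕ) = 0).card : ℝ) := by
  simp [idle]

theorem idle_eq_zero_iff (F : Finset (Fin N)) (q : State N b) :
    idle F q = 0 ↔ ∀ n ∈ F, 1 ≤ (q n : ℕ) := by
  rw [idle_eq_card, Nat.cast_eq_zero, Finset.card_eq_zero, Finset.filter_eq_empty_iff]
  exact forall₂_congr fun n _ => by omega

theorem exists_of_idle_ne_zero {F : Finset (Fin N)} {q : State N b} (h : idle F q ≠ 0) :
    ∃ n ∈ F, (q n : ℕ) = 0 := by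
  rw [Ne, idle_eq_zero_iff] at h
  push Not at h
  obtain ⟨n, hn, h⟩ := h
  exact ⟨n, hn, by omega⟩

variable {μ : Fin N → ℝ} {q : State N b} {n : Fin N}

theorem le_of_mem_targets (hn : n ∈ targets μ q) (m : Fin N) : q n ≤ q m := by
  simp only [targets, shortest, Finset.mem_filter] at hn
  exact hn.1.2 m

theorem eq_zero_of_mem_targets (hn : n ∈ targets μ q) (h : idle Finset.univ q ≠ 0) :
    (q n : ℕ) = 0 := by
  obtain ⟨m, -, hm⟩ := exists_of_idle_ne_zero h
  have : (q n : ℕ) ≤ q m := le_of_mem_targets hn m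
  omega

theorem idle_univ_ne_zero {F : Finset (Fin N)} (h : idle F q ≠ 0) : idle Finset.univ q ≠ 0 := by
  obtain ⟨m, -, hm⟩ := exists_of_idle_ne_zero h
  rw [Ne, idle_eq_zero_iff]
  intro h'
  have := h' m (Finset.mem_univ m)
  omega

/-- Among idle servers JFSQ picks a largest rate, so an idle server of rate above 2 forces the
target to have rate above 2 as well. -/
theorem mem_fast_of_mem_targets (hn : n ∈ targets μ q) (h : idle (fast μ) q ≠ 0) :
    n ∈ fast μ := by
  obtain ⟨m, hm, hm0⟩ := exists_of_idle_ne_zero h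
  simp only [targets, shortest, Finset.mem_filter, Finset.mem_univ, true_and] at hn
  have := hn.2 m fun k => by rw [Fin.le_def, hm0]; exact Nat.zero_le _
  simp only [fast, Finset.mem_filter, Finset.mem_univ, true_and] at hm ⊢
  linarith

theorem targets_nonempty [NeZero N] (μ : Fin N → ℝ) (q : State N b) : (targets μ q).Nonempty := by
  have h1 : (shortest q).Nonempty := by
    obtain ⟨n, -, hn⟩ := Finset.exists_min_image Finset.univ q ⟨0, Finset.mem_univ _⟩
    exact ⟨n, by simpa [shortest] using hn⟩
  obtain ⟨n, hn, h⟩ := Finset.exists_max_image (shortest q) μ h1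
  exact ⟨n, by simpa [targets, hn] using h⟩

theorem route_nonneg (μ : Fin N → ℝ) (q : State N b) (n : Fin N) : 0 ≤ route μ q n := by
  unfold route; split_ifs <;> positivity

theorem sum_route [NeZero N] (μ : Fin N → ℝ) (q : State N b) : ∑ n, route μ q n = 1 := by
  have h : ((targets μ q).card : ℝ) ≠ 0 := by
    exact_mod_cast (targets_nonempty μ q).card_pos.ne'
  simp [route, h]

theorem sum_route_mul_le [NeZero N] {c : ℝ} {g : Fin N → ℝ} (h : ∀ n ∈ targets μ q, g n ≤ c) :
    ∑ n, route μ q n * g n ≤ c := by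
  calc ∑ n, route μ q n * g n ≤ ∑ n, route μ q n * c := by
        refine Finset.sum_le_sum fun n _ => ?_
        by_cases hn : n ∈ targets μ q
        · exact mul_le_mul_of_nonneg_left (h n hn) (route_nonneg _ _ _)
        · simp [route, hn]
    _ = c := by rw [← Finset.sum_mul, sum_route, one_mul]

/-- Arrivals reach only `targets` and idle servers have no departures, so worst-case increments per
type of event suffice. It is applied with `F` equal to `Finset.univ` or to `fast μ`. -/
theorem generator_le [NeZero N] {α : ℝ} (hL : 0 ≤ load N α * N) (hμ : ∀ n, 0 ≤ μ n)
    {f : State N b → ℝ} {a d₁ d₂ : ℝ} (F : Finset (Fin N))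
    (ha : ∀ n ∈ targets μ q, f (arrive q n) - f q ≤ a)
    (h₁ : ∀ n ∈ F, (q n : ℕ) = 1 → f (depart q n) - f q ≤ d₁)
    (h₁' : ∀ n ∉ F, (q n : ℕ) = 1 → f (depart q n) - f q ≤ 0)
    (h₂ : ∀ n, 2 ≤ (q n : ℕ) → f (depart q n) - f q ≤ d₂) :
    generator α μ f q ≤ load N α * N * a + (singleRate μ F q * d₁ + queueRate μ q * d₂) := by
  unfold generator
  refine add_le_add ?_ ?_
  · simp_rw [mul_assoc (load N α * N)]
    rw [← Finset.mul_sum]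
    exact mul_le_mul_of_nonneg_left (sum_route_mul_le ha) hL
  · have hs : singleRate μ F q =
        ∑ n, if n ∈ F then (if (q n : ℕ) = 1 then μ n else 0) else 0 := by
      simp [singleRate]
    rw [hs, queueRate, Finset.sum_mul, Finset.sum_mul, ← Finset.sum_add_distrib]
    refine Finset.sum_le_sum fun n _ => ?_
    rcases lt_trichotomy (q n : ℕ) 1 with h | h | h
    · have h0 : (q n : ℕ) = 0 := by omega
      simp [h0]
    · by_cases hF : n ∈ F
      · have := mul_le_mul_of_nonneg_left (h₁ n hF h) (hμ n)
        simpa [h, hF] using this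
      · have := mul_le_mul_of_nonneg_left (h₁' n hF h) (hμ n)
        simpa [h, hF] using this
    · have := mul_le_mul_of_nonneg_left (h₂ n h) (hμ n)
      have h1 : (q n : ℕ) ≠ 1 := by omega
      have h2 : 2 ≤ (q n : ℕ) := h
      have h3 : 1 ≤ (q n : ℕ) := by omega
      simpa [h1, h2, h3] using this

theorem IsStationary.sum_nonneg_of_generator_le {α : ℝ} {π : State N b → ℝ}
    (hπ : IsStationary α μ π) (f g : State N b → ℝ) (h : ∀ q, generator α μ f q ≤ g q) :
    0 ≤ ∑ q, π q * g q :=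
  (hπ.balance f).symm.trans_le
    (Finset.sum_le_sum fun q _ => mul_le_mul_of_nonneg_left (h q) (hπ.nonneg q))

theorem idleRate_add_singleRate_add_queueRate (μ : Fin N → ℝ) (q : State N b) :
    idleRate μ q + singleRate μ Finset.univ q + queueRate μ q = ∑ n, μ n := by
  simp only [idleRate, singleRate, queueRate, ← Finset.sum_add_distrib]
  refine Finset.sum_congr rfl fun n _ => ?_
  rcases lt_trichotomy (q n : ℕ) 1 with h | h | h
  · have h0 : (q n : ℕ) = 0 := by omega
    simp [h0]
  · simp [h]
  · have h1 : (q n : ℕ) ≠ 1 := by omega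
    have h2 : 2 ≤ (q n : ℕ) := h
    have h3 : (q n : ℕ) ≠ 0 := by omega
    simp [h1, h2, h3]

theorem singleRate_nonneg (hμ : ∀ n, 0 ≤ μ n) (F : Finset (Fin N)) (q : State N b) :
    0 ≤ singleRate μ F q :=
  Finset.sum_nonneg fun n _ => by split_ifs; exacts [hμ n, le_rfl]

theorem queueRate_nonneg (hμ : ∀ n, 0 ≤ μ n) (q : State N b) : 0 ≤ queueRate μ q :=
  Finset.sum_nonneg fun n _ => by split_ifs; exacts [hμ n, le_rfl]

theorem idleRate_nonneg (hμ : ∀ n, 0 ≤ μ n) (q : State N b) : 0 ≤ idleRate μ q :=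
  Finset.sum_nonneg fun n _ => by split_ifs; exacts [hμ n, le_rfl]

theorem singleRate_le (hμ : ∀ n, 0 ≤ μ n) (F : Finset (Fin N)) (q : State N b) :
    singleRate μ F q ≤ ∑ n ∈ F, μ n :=
  Finset.sum_le_sum fun n _ => by split_ifs; exacts [le_rfl, hμ n]

theorem idleRate_eq_zero (h : idle Finset.univ q = 0) : idleRate μ q = 0 := by
  rw [idle_eq_zero_iff] at h
  refine Finset.sum_eq_zero fun n hn => if_neg ?_
  have := h n hn
  omega

theorem mul_idle_le_idleRate {ε : ℝ} (h : ∀ n, ε ≤ μ n) (q : State N b) :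
    ε * idle Finset.univ q ≤ idleRate μ q := by
  rw [idle, idleRate, Finset.mul_sum]
  refine Finset.sum_le_sum fun n _ => ?_
  split_ifs <;> simp [h]

/-- The large factor `m` multiplies only the idle fast servers, which the routing rule keeps few. -/
theorem idleRate_le {m : ℝ} (hm : ∀ n, μ n ≤ m) (q : State N b) :
    idleRate μ q ≤ 2 * idle Finset.univ q + m * idle (fast μ) q := by
  have hs : idle (fast μ) q = ∑ n, if n ∈ fast μ then (if (q n : ℕ) = 0 then 1 else 0) else 0 := by
    simp [idle]
  rw [hs, idle, idleRate, Finset.mul_sum, Finset.mul_sum, ← Finset.sum_add_distrib]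
  refine Finset.sum_le_sum fun n _ => ?_
  by_cases h : (q n : ℕ) = 0 <;> by_cases hF : n ∈ fast μ <;> simp only [h, hF, if_true, if_false]
  · have := hm n; linarith
  · simp only [fast, Finset.mem_filter, Finset.mem_univ, true_and, not_lt] at hF
    linarith
  · simp
  · simp

theorem queueRate_le {m : ℝ} (hm : ∀ n, μ n ≤ m) (hm0 : 0 ≤ m) (q : State N b) :
    queueRate μ q ≤ m * waiting q := by
  rw [queueRate, waiting, Finset.mul_sum]
  refine Finset.sum_le_sum fun n _ => ?_
  split_ifs with h
  · have : (1 : ℝ) ≤ (((q n : ℕ) - 1 : ℕ) : ℝ) := by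
      exact_mod_cast (by omega : 1 ≤ (q n : ℕ) - 1)
    nlinarith [hm n]
  · positivity

theorem mul_waiting_le {ε : ℝ} (hε : 0 < ε) (h : ∀ n, ε ≤ μ n) (q : State N b) :
    ε * waiting q ≤ b * queueRate μ q := by
  rw [queueRate, waiting, Finset.mul_sum, Finset.mul_sum]
  refine Finset.sum_le_sum fun n _ => ?_
  split_ifs with h2
  · have h3 : (((q n : ℕ) - 1 : ℕ) : ℝ) ≤ b := by
      exact_mod_cast (by have := (q n).isLt; omega : (q n : ℕ) - 1 ≤ b)
    have := h n
    rw [mul_comm]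
    exact mul_le_mul h3 this hε.le (Nat.cast_nonneg _)
  · have : (q n : ℕ) - 1 = 0 := by omega
    simp [this]

end

/-! ### The law of the waiting time -/

section

variable {N b : ℕ}

theorem integrable_and_integral_expMeasure {ρ : ℝ} (hρ : 0 < ρ) :
    Integrable (fun x : ℝ => x) (expMeasure ρ) ∧ ∫ x, x ∂(expMeasure ρ) = ρ⁻¹ := by
  have hfin : ∀ᵐ x : ℝ, gammaPDF 1 ρ x < ⊤ := Filter.Eventually.of_forall fun x => by
    simp [gammaPDF]
  have hm : Measurable (gammaPDF 1 ρ) := (measurable_gammaPDFReal 1 ρ).ennreal_ofReal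
  -- The exponent `2 - 1` exhibits the first moment as a Gamma integral at 2. At x = 0, outside
  -- `Set.Ioi 0`, the factor x vanishes.
  have hd : (fun x : ℝ => (gammaPDF 1 ρ x).toReal • x) =
      (Set.Ioi (0 : ℝ)).indicator fun x => ρ * (x ^ (2 - 1 : ℝ) * Real.exp (-(ρ * x))) := by
    funext x
    by_cases hx : 0 < x
    · have h1 : 0 ≤ ρ * Real.exp (-(ρ * x)) := by positivity
      have h2 : (2 - 1 : ℝ) = 1 := by norm_num
      simp only [gammaPDF_of_nonneg hx.le, Set.indicator, Set.mem_Ioi, hx, if_true, h2]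
      simp only [Real.rpow_one, Real.Gamma_one, div_one, sub_self, Real.rpow_zero, mul_one]
      rw [ENNReal.toReal_ofReal h1, smul_eq_mul]
      ring
    · rcases (not_lt.mp hx).lt_or_eq with h | h
      · simp [gammaPDF_of_neg h, Set.indicator, hx]
      · simp [h]
  have hint : IntegrableOn (fun x : ℝ => ρ * (x ^ (2 - 1 : ℝ) * Real.exp (-(ρ * x))))
      (Set.Ioi 0) := by
    have := integrableOn_rpow_mul_exp_neg_mul_rpow (p := 1) (s := 1) (by norm_num) one_pos hρ
    refine IntegrableOn.congr_fun (this.const_mul ρ) (fun x _ => ?_) measurableSet_Ioi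
    norm_num
  rw [expMeasure, gammaMeasure]
  constructor
  · rw [integrable_withDensity_iff_integrable_smul' hm hfin, hd]
    exact hint.integrable_indicator measurableSet_Ioi
  · rw [integral_withDensity_eq_integral_toReal_smul hm hfin, hd,
      integral_indicator measurableSet_Ioi, integral_const_mul,
      Real.integral_rpow_mul_exp_neg_mul_Ioi (by norm_num) hρ, Real.Gamma_two]
    norm_num
    field_simp

theorem integrable_erlang (k : ℕ) {ρ : ℝ} (hρ : 0 < ρ) :
    Integrable (fun x : ℝ => x) (erlang k ρ) := by
  have := isProbabilityMeasure_expMeasure hρ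
  rw [erlang, integrable_map_measure (by fun_prop) (by fun_prop)]
  exact integrable_finsetSum _ fun i _ =>
    integrable_comp_eval (μ := fun _ : Fin k => expMeasure ρ) (i := i)
      (integrable_and_integral_expMeasure hρ).1

theorem integral_erlang (k : ℕ) {ρ : ℝ} (hρ : 0 < ρ) :
    ∫ x, x ∂(erlang k ρ) = k * ρ⁻¹ := by
  have := isProbabilityMeasure_expMeasure hρ
  rw [erlang, integral_map (by fun_prop) (by fun_prop), integral_finsetSum]
  · have h : ∀ i : Fin k, ∫ s : Fin k → ℝ, s i ∂(Measure.pi fun _ => expMeasure ρ) = ρ⁻¹ :=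
      fun i => (integral_comp_eval (μ := fun _ : Fin k => expMeasure ρ) (i := i)
        (f := fun x : ℝ => x) (by fun_prop)).trans (integrable_and_integral_expMeasure hρ).2
    simp [h]
  · exact fun i _ =>
      integrable_comp_eval (μ := fun _ : Fin k => expMeasure ρ) (i := i)
      (integrable_and_integral_expMeasure hρ).1

theorem blockProb_le_waitProb (hb : 1 ≤ b) {μ : Fin N → ℝ} {π : State N b → ℝ}
    (hπ : ∀ q, 0 ≤ π q) : blockProb μ π ≤ waitProb μ π := by
  refine Finset.sum_le_sum fun q _ => Finset.sum_le_sum fun n _ => ?_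
  have := mul_nonneg (hπ q) (route_nonneg μ q n)
  split_ifs
  · rfl
  · omega
  · exact this
  · rfl

theorem integrable_waitLaw {μ : Fin N → ℝ} (hμ : ∀ n, 0 < μ n) (π : State N b → ℝ) :
    Integrable (fun w : ℝ => w) (waitLaw μ π) := by
  refine integrable_finsetSum_measure.mpr fun q _ =>
    integrable_finsetSum_measure.mpr fun n _ => ?_
  split_ifs
  · exact (integrable_erlang _ (hμ n)).smul_measure ENNReal.ofReal_ne_top
  · exact integrable_zero_measure

/-- An accepted job behind k ≥ 1 others waits k/μ_n ≤ b/ε on average, one that finds its server idle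
waits 0, and conditioning on acceptance costs at most a factor 2. -/
theorem integral_waitLaw_le {ε : ℝ} (hε : 0 < ε) {μ : Fin N → ℝ} (hμ : ∀ n, ε ≤ μ n)
    {π : State N b → ℝ} (hπ : ∀ q, 0 ≤ π q) (hB : blockProb μ π ≤ 1 / 2) :
    ∫ w, w ∂(waitLaw μ π) ≤ 2 * b / ε * waitProb μ π := by
  have hpos : ∀ n, 0 < μ n := fun n => hε.trans_le (hμ n)
  have hi := integrable_waitLaw hpos π
  have hi' := integrable_finsetSum_measure.mp hi
  rw [waitLaw, integral_finsetSum_measure hi', waitProb, Finset.mul_sum]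
  refine Finset.sum_le_sum fun q _ => ?_
  rw [integral_finsetSum_measure (integrable_finsetSum_measure.mp (hi' q (Finset.mem_univ q))),
    Finset.mul_sum]
  refine Finset.sum_le_sum fun n _ => ?_
  have hw : 0 ≤ π q * route μ q n := mul_nonneg (hπ q) (route_nonneg μ q n)
  by_cases h : (q n : ℕ) < b
  · have hc : 0 ≤ π q * route μ q n / (1 - blockProb μ π) := div_nonneg hw (by linarith)
    rw [if_pos h, integral_smul_measure, integral_erlang _ (hpos n), ENNReal.toReal_ofReal hc,
      smul_eq_mul]
    by_cases h1 : 1 ≤ (q n : ℕ)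
    · rw [if_pos h1]
      have h2 : π q * route μ q n / (1 - blockProb μ π) ≤ 2 * (π q * route μ q n) := by
        rw [div_le_iff₀ (by linarith)]
        nlinarith
      have h3 : ((q n : ℕ) : ℝ) * (μ n)⁻¹ ≤ b * ε⁻¹ :=
        mul_le_mul (by exact_mod_cast h.le) (inv_anti₀ hε (hμ n)) (inv_pos.mpr (hpos n)).le
          (Nat.cast_nonneg _)
      calc _ ≤ 2 * (π q * route μ q n) * (b * ε⁻¹) :=
            mul_le_mul h2 h3 (mul_nonneg (Nat.cast_nonneg _) (inv_pos.mpr (hpos n)).le)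
              (by positivity)
        _ = _ := by ring
    · have h0 : (q n : ℕ) = 0 := by omega
      simp [h0]
  · rw [if_neg h, integral_zero_measure]
    split_ifs <;> positivity

end

/-! ### Exponential test functions: the Sub-Halfin–Whitt bound -/

section

variable {N b : ℕ}

theorem waitProb_eq [NeZero N] (μ : Fin N → ℝ) (π : State N b → ℝ) :
    waitProb μ π = ∑ q, π q * if idle Finset.univ q = 0 then 1 else 0 := by
  refine Finset.sum_congr rfl fun q _ => ?_
  split_ifs with h
  · rw [idle_eq_zero_iff] at h
    rw [← sum_route μ q, Finset.mul_sum]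
    exact Finset.sum_congr rfl fun n hn => if_pos (h n hn)
  · rw [mul_zero]
    refine Finset.sum_eq_zero fun n _ => ?_
    split_ifs with h1
    · by_cases hn : n ∈ targets μ q
      · have := eq_zero_of_mem_targets hn h; omega
      · simp [route, hn]
    · rfl

theorem exp_sub_one_le_and {x : ℝ} (h0 : 0 ≤ x) (h1 : x ≤ 1) :
    Real.exp x - 1 ≤ x + x ^ 2 ∧ Real.exp (-x) - 1 ≤ -x + x ^ 2 := by
  have a := abs_le.mp (Real.abs_exp_sub_one_sub_id_le (x := x) (by rw [abs_of_nonneg h0]; exact h1))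
  have c := abs_le.mp (Real.abs_exp_sub_one_sub_id_le (x := -x)
    (by rw [abs_neg, abs_of_nonneg h0]; exact h1))
  constructor
  · linarith [a.2]
  · have := c.2; rw [neg_sq] at this; linarith

variable {α ε : ℝ} {μ : Fin N → ℝ} {π : State N b → ℝ}

/-- The function smooths θ(Y - I): exp(-θI) has slope -θ at I = 0, matching the θ gained by a
waiting job. The first-order drift is thus θ exp(-θI)(Z - D) on both sides of the boundary; queue
departures give -θ ≤ -θ exp(-θI), and second-order terms cost at most 2Nθ². -/
theorem generator_waiting_add_exp_idle_le [NeZero N] (hb : 1 ≤ b) (hL : 0 ≤ load N α * N)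
    (hμ : ∀ n, 0 ≤ μ n) (htot : ∑ n, μ n = N) (hLN : load N α * N ≤ N) {θ : ℝ} (h0 : 0 ≤ θ)
    (h1 : θ ≤ 1) (q : State N b) :
    generator α μ (fun q => θ * waiting q + Real.exp (-θ * idle Finset.univ q)) q ≤
      θ * (Real.exp (-θ * idle Finset.univ q) *
        (idleRate μ q - (N - load N α * N) + 2 * N * θ)) := by
  obtain ⟨e1, e2⟩ := exp_sub_one_le_and h0 h1
  have hsum := idleRate_add_singleRate_add_queueRate μ q
  rw [htot] at hsum
  have hB1 := singleRate_nonneg hμ Finset.univ q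
  have hB2 := queueRate_nonneg hμ q
  have hZ := idleRate_nonneg hμ q
  have hN : (0 : ℝ) ≤ N := Nat.cast_nonneg _
  set L := load N α * N
  set e := Real.exp (-θ * idle Finset.univ q) with he
  have he0 : 0 ≤ e := (Real.exp_pos _).le
  have he1 : e ≤ 1 := Real.exp_le_one_iff.mpr (by nlinarith [idle_nonneg Finset.univ q])
  have hd1 : ∀ n, (q n : ℕ) = 1 → θ * waiting (depart q n) +
      Real.exp (-θ * idle Finset.univ (depart q n)) - (θ * waiting q + e) ≤
      e * (-θ + θ ^ 2) := by
    intro n hn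
    rw [waiting_depart, idle_depart _ _ _ hn.ge]
    simp only [hn, Finset.mem_univ, and_self, if_true]
    have : Real.exp (-θ * (idle Finset.univ q + 1)) = e * Real.exp (-θ) := by
      rw [he, ← Real.exp_add]; ring_nf
    rw [this]
    norm_num
    nlinarith
  have hd2 : ∀ n, 2 ≤ (q n : ℕ) → θ * waiting (depart q n) +
      Real.exp (-θ * idle Finset.univ (depart q n)) - (θ * waiting q + e) ≤ -θ := by
    intro n hn
    rw [waiting_depart, idle_depart _ _ _ (by omega)]
    have h1 : (q n : ℕ) ≠ 1 := by omega
    simp only [hn, h1, and_false, if_true, if_false, add_zero]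
    linarith
  by_cases hI : idle Finset.univ q = 0
  · have hZ0 : idleRate μ q = 0 := idleRate_eq_zero hI
    have he' : e = 1 := by rw [he, hI]; simp
    refine (generator_le (a := θ) (d₁ := e * (-θ + θ ^ 2)) (d₂ := -θ) hL hμ Finset.univ
      (fun n _ => ?_) (fun n _ => hd1 n) (by simp) hd2).trans ?_
    · show θ * waiting (arrive q n) + Real.exp (-θ * idle Finset.univ (arrive q n)) -
        (θ * waiting q + e) ≤ θ
      have hn := (idle_eq_zero_iff _ _).mp hI n (Finset.mem_univ n)
      have h2 : (q n : ℕ) ≠ 0 := by omega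
      rw [waiting_arrive, idle_arrive hb]
      simp only [h2, and_false, if_false, sub_zero]
      split_ifs <;> linarith
    · rw [hZ0, he']
      have : singleRate μ Finset.univ q = N - queueRate μ q := by linarith
      rw [this]
      nlinarith [mul_nonneg (mul_nonneg h0 h0) hB2, mul_nonneg (mul_nonneg h0 h0) hN]
  · refine (generator_le (a := e * (θ + θ ^ 2)) (d₁ := e * (-θ + θ ^ 2)) (d₂ := -θ) hL hμ
      Finset.univ (fun n hn => ?_) (fun n _ => hd1 n) (by simp) hd2).trans ?_
    · show θ * waiting (arrive q n) + Real.exp (-θ * idle Finset.univ (arrive q n)) -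
        (θ * waiting q + e) ≤ e * (θ + θ ^ 2)
      have hn0 := eq_zero_of_mem_targets hn hI
      rw [waiting_arrive, idle_arrive hb]
      simp only [hn0, Finset.mem_univ, and_self, if_true]
      have : Real.exp (-θ * (idle Finset.univ q - 1)) = e * Real.exp θ := by
        rw [he, ← Real.exp_add]; ring_nf
      rw [this]
      norm_num
      nlinarith
    · have : singleRate μ Finset.univ q = N - idleRate μ q - queueRate μ q := by linarith
      rw [this]
      have k1 : 0 ≤ θ * queueRate μ q * (1 - e) :=
        mul_nonneg (mul_nonneg h0 hB2) (by linarith)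
      have k2 : 0 ≤ θ * (θ * e) * (N - L) :=
        mul_nonneg (mul_nonneg h0 (mul_nonneg h0 he0)) (by linarith)
      have k3 : 0 ≤ θ * (θ * e) * (idleRate μ q + queueRate μ q) :=
        mul_nonneg (mul_nonneg h0 (mul_nonneg h0 he0)) (by linarith)
      nlinarith

/-- While a fast server is idle, arrivals lower I_F at rate λN and departures raise it at rate at
most the total fast rate, which is smaller by εN/4. The additive constant covers the states with I_F
= 0. -/
theorem generator_exp_idle_fast_le [NeZero N] (hb : 1 ≤ b) (hε : 0 < ε) (hε1 : ε ≤ 1)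
    (hμ : ∀ n, 0 ≤ μ n) (hLN : load N α * N ≤ N)
    (hF : ∑ n ∈ fast μ, μ n + ε * N / 4 ≤ load N α * N) (q : State N b) :
    generator α μ (fun q => Real.exp (ε / 16 * idle (fast μ) q)) q ≤
      ε / 16 * N * (3 - ε / 8 * Real.exp (ε / 16 * idle (fast μ) q)) := by
  have hη0 : 0 < ε / 16 := by positivity
  set η := ε / 16 with hη
  have hεη : ε = 16 * η := by rw [hη]; ring
  have hη1 : η ≤ 1 / 16 := by rw [hη]; linarith
  obtain ⟨e1, e2⟩ := exp_sub_one_le_and hη0.le (by linarith)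
  have hN : (0 : ℝ) < N := by exact_mod_cast NeZero.pos N
  have hS0 : 0 ≤ ∑ n ∈ fast μ, μ n := Finset.sum_nonneg fun n _ => hμ n
  have hL : 0 ≤ load N α * N := by nlinarith
  have hB1 := singleRate_le hμ (fast μ) q
  have hB0 := singleRate_nonneg hμ (fast μ) q
  set L := load N α * N
  set S := ∑ n ∈ fast μ, μ n
  set e := Real.exp (η * idle (fast μ) q) with he
  have he1 : 1 ≤ e := Real.one_le_exp (mul_nonneg hη0.le (idle_nonneg _ _))
  have hd1 : ∀ n ∈ fast μ, (q n : ℕ) = 1 →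
      Real.exp (η * idle (fast μ) (depart q n)) - e ≤ e * (η + η ^ 2) := by
    intro n hn h1
    rw [idle_depart _ _ _ h1.ge]
    simp only [hn, h1, and_self, if_true]
    rw [mul_add, Real.exp_add, mul_one, ← he]
    nlinarith
  have hd1' : ∀ n ∉ fast μ, (q n : ℕ) = 1 →
      Real.exp (η * idle (fast μ) (depart q n)) - e ≤ 0 := by
    intro n hn h1
    rw [idle_depart _ _ _ h1.ge]
    simp [hn, he]
  have hd2 : ∀ n, 2 ≤ (q n : ℕ) →
      Real.exp (η * idle (fast μ) (depart q n)) - e ≤ 0 := by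
    intro n hn
    rw [idle_depart _ _ _ (by omega)]
    have h1 : (q n : ℕ) ≠ 1 := by omega
    simp [h1, he]
  by_cases hI : idle (fast μ) q = 0
  · have he' : e = 1 := by rw [he, hI]; simp
    refine (generator_le (a := 0) hL hμ (fast μ) (fun n _ => ?_) hd1 hd1' hd2).trans ?_
    · show Real.exp (η * idle (fast μ) (arrive q n)) - e ≤ 0
      rw [idle_arrive hb, he]
      have : ¬(n ∈ fast μ ∧ (q n : ℕ) = 0) := fun h => by
        have := (idle_eq_zero_iff _ _).mp hI n h.1; omega
      rw [if_neg this]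
      simp
    · rw [he']
      have : singleRate μ (fast μ) q ≤ N := by nlinarith
      have := mul_le_mul_of_nonneg_right this (by positivity : 0 ≤ η + η ^ 2)
      rw [hεη]
      nlinarith [mul_pos hη0 hN]
  · refine (generator_le (a := e * (-η + η ^ 2)) hL hμ (fast μ)
      (fun n hn => ?_) hd1 hd1' hd2).trans ?_
    · show Real.exp (η * idle (fast μ) (arrive q n)) - e ≤ _
      have h1 := mem_fast_of_mem_targets hn hI
      have h2 := eq_zero_of_mem_targets hn (idle_univ_ne_zero hI)
      rw [idle_arrive hb]
      simp only [h1, h2, and_self, if_true]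
      have : Real.exp (η * (idle (fast μ) q - 1)) = e * Real.exp (-η) := by
        rw [he, ← Real.exp_add]; ring_nf
      rw [this]
      nlinarith
    · have h3 : singleRate μ (fast μ) q * (e * (η + η ^ 2)) ≤ S * (e * (η + η ^ 2)) :=
        mul_le_mul_of_nonneg_right hB1 (by positivity)
      -- With ε = 16η the rate gap is 4ηN, so the gain 4η²N is twice the second-order loss 2η²N.
      have h4 : L * (-η + η ^ 2) + S * (η + η ^ 2) ≤ -(2 * η ^ 2 * N) := by
        have : S + L ≤ 2 * N := by nlinarith
        rw [hεη] at hF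
        nlinarith [mul_le_mul_of_nonneg_left this (by positivity : 0 ≤ η ^ 2)]
      rw [hεη]
      nlinarith [mul_le_mul_of_nonneg_left h4 (by linarith : 0 ≤ e), mul_pos hη0 hN]

theorem expect_exp_idle_fast_le [NeZero N] (hb : 1 ≤ b) (hε : 0 < ε) (hε1 : ε ≤ 1)
    (hμ : ∀ n, 0 ≤ μ n) (hLN : load N α * N ≤ N)
    (hF : ∑ n ∈ fast μ, μ n + ε * N / 4 ≤ load N α * N) (hπ : IsStationary α μ π) :
    ∑ q, π q * Real.exp (ε / 16 * idle (fast μ) q) ≤ 24 / ε := by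
  have hN : (0 : ℝ) < N := by exact_mod_cast NeZero.pos N
  have h := hπ.sum_nonneg_of_generator_le _ _
    (generator_exp_idle_fast_le hb hε hε1 hμ hLN hF)
  have h2 : ∑ q, π q * (ε / 16 * N * (3 - ε / 8 * Real.exp (ε / 16 * idle (fast μ) q))) =
      ε / 16 * N * (3 - ε / 8 * ∑ q, π q * Real.exp (ε / 16 * idle (fast μ) q)) := by
    have e : ∀ q, π q * (ε / 16 * N * (3 - ε / 8 * Real.exp (ε / 16 * idle (fast μ) q))) =
        ε / 16 * N * 3 * π q -
          ε / 16 * N * (ε / 8) * (π q * Real.exp (ε / 16 * idle (fast μ) q)) := fun q => by ring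
    simp_rw [e]
    rw [Finset.sum_sub_distrib, ← Finset.mul_sum, ← Finset.mul_sum, hπ.sum_eq_one]
    ring
  rw [h2] at h
  have h3 := nonneg_of_mul_nonneg_right h (by positivity)
  rw [le_div_iff₀ hε]
  linarith

/-- The drift of `θ * waiting + exp (-θ * idle)` with `θ = D / (8 * N)` is at most
`θ * exp (-θ * idle) * (idleRate - 3 / 4 * D)`, and `idleRate` exceeds `3 / 4 * D` only if there are
many idle servers or many fast idle servers. -/
theorem waitProb_mul_le_exp [NeZero N] (hb : 1 ≤ b) (hε : 0 < ε) (hε1 : ε ≤ 1)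
    (hμ : ∀ n, ε ≤ μ n) {m : ℝ} (hm : ∀ n, μ n ≤ m) (htot : ∑ n, μ n = N)
    (hL : 0 ≤ load N α * N) (hLN : load N α * N < N)
    (hF : ∑ n ∈ fast μ, μ n + ε * N / 4 ≤ load N α * N) (hπ : IsStationary α μ π) {D : ℝ}
    (hD : D = N - load N α * N) :
    3 / 4 * D * waitProb μ π ≤
      N * Real.exp (-(D ^ 2 / (32 * N))) + N * (24 / ε * Real.exp (-(ε / 16 * (D / (4 * m))))) := by
  have hN : (0 : ℝ) < N := by exact_mod_cast NeZero.pos N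
  have hD0 : 0 < D := by linarith
  have hDN : D ≤ N := by linarith
  have hμ0 : ∀ n, 0 ≤ μ n := fun n => hε.le.trans (hμ n)
  have hm0 : 0 < m := (hε.trans_le (hμ 0)).trans_le (hm 0)
  set θ := D / (8 * N) with hθ
  have hθ0 : 0 < θ := by positivity
  have hθN : 2 * N * θ = D / 4 := by rw [hθ]; field_simp; ring
  have hθ1 : θ ≤ 1 := by rw [hθ, div_le_one (by positivity)]; linarith
  have h := hπ.sum_nonneg_of_generator_le _ _
    (generator_waiting_add_exp_idle_le hb hL hμ0 htot hLN.le hθ0.le hθ1)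
  rw [hθN, ← hD] at h
  set R : State N b → ℝ := fun q => N * Real.exp (-(D ^ 2 / (32 * N))) +
    N * (Real.exp (ε / 16 * idle (fast μ) q) * Real.exp (-(ε / 16 * (D / (4 * m))))) with hR
  have key : ∀ q : State N b, 3 / 4 * D * (if idle Finset.univ q = 0 then 1 else 0) +
      Real.exp (-θ * idle Finset.univ q) * (idleRate μ q - D + D / 4) ≤ R q := by
    intro q
    have hZ0 := idleRate_nonneg hμ0 q
    have hsum := idleRate_add_singleRate_add_queueRate μ q
    have hB1 := singleRate_nonneg hμ0 Finset.univ q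
    have hB2 := queueRate_nonneg hμ0 q
    have hZN : idleRate μ q ≤ N := by linarith
    have hR1 : 0 ≤ N * Real.exp (-(D ^ 2 / (32 * N))) := by positivity
    have hR2 : 0 ≤ N * (Real.exp (ε / 16 * idle (fast μ) q) *
      Real.exp (-(ε / 16 * (D / (4 * m))))) := by positivity
    have hI0 := idle_nonneg Finset.univ q
    have he1 : Real.exp (-θ * idle Finset.univ q) ≤ 1 :=
      Real.exp_le_one_iff.mpr (by nlinarith)
    have he0 := Real.exp_pos (-θ * idle Finset.univ q)
    split_ifs with hI
    · rw [hI, idleRate_eq_zero hI]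
      simp only [mul_zero, Real.exp_zero, hR]
      linarith
    · rw [mul_zero, zero_add]
      by_cases hZ : idleRate μ q ≤ 3 / 4 * D
      · have : Real.exp (-θ * idle Finset.univ q) * (idleRate μ q - D + D / 4) ≤ 0 :=
          mul_nonpos_of_nonneg_of_nonpos he0.le (by linarith)
        simp only [hR]; linarith
      · have hle : Real.exp (-θ * idle Finset.univ q) * (idleRate μ q - D + D / 4) ≤
            N * Real.exp (-θ * idle Finset.univ q) := by
          rw [mul_comm (N : ℝ)]
          exact mul_le_mul_of_nonneg_left (by linarith) he0.le
        by_cases hI4 : D / 4 ≤ idle Finset.univ q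
        · have : Real.exp (-θ * idle Finset.univ q) ≤ Real.exp (-(D ^ 2 / (32 * N))) := by
            rw [Real.exp_le_exp]
            have : D ^ 2 / (32 * N) = θ * (D / 4) := by rw [hθ]; field_simp; ring
            rw [this]
            nlinarith
          have := mul_le_mul_of_nonneg_left this hN.le
          simp only [hR]; linarith
        · have hf := idleRate_le hm q
          -- Here Z > 3D/4 and I < D/4, so Z ≤ 2I + m I_F leaves m I_F > D/4.
          have h2 : D / (4 * m) ≤ idle (fast μ) q := by
            rw [div_le_iff₀ (by positivity)]
            nlinarith
          have : (1 : ℝ) ≤ Real.exp (ε / 16 * idle (fast μ) q) *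
              Real.exp (-(ε / 16 * (D / (4 * m)))) := by
            rw [← Real.exp_add]
            refine Real.one_le_exp ?_
            nlinarith
          have h5 := mul_le_mul_of_nonneg_left this hN.le
          have h6 := mul_le_mul_of_nonneg_left he1 hN.le
          simp only [hR]; linarith
  have hE := expect_exp_idle_fast_le hb hε hε1 hμ0 hLN.le hF hπ
  have h1 : 0 ≤ ∑ q, π q * (Real.exp (-θ * idle Finset.univ q) * (idleRate μ q - D + D / 4)) := by
    refine nonneg_of_mul_nonneg_right (a := θ) ?_ hθ0
    rw [Finset.mul_sum]
    exact h.trans_eq (Finset.sum_congr rfl fun q _ => by ring)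
  have h2 : 3 / 4 * D * waitProb μ π ≤ ∑ q, π q * R q := by
    calc 3 / 4 * D * waitProb μ π
        ≤ 3 / 4 * D * waitProb μ π + ∑ q, π q *
          (Real.exp (-θ * idle Finset.univ q) * (idleRate μ q - D + D / 4)) := by linarith
      _ = ∑ q, π q * (3 / 4 * D * (if idle Finset.univ q = 0 then 1 else 0) +
          Real.exp (-θ * idle Finset.univ q) * (idleRate μ q - D + D / 4)) := by
        rw [waitProb_eq, Finset.mul_sum, ← Finset.sum_add_distrib]
        exact Finset.sum_congr rfl fun q _ => by ring
      _ ≤ _ := Finset.sum_le_sum fun q _ => mul_le_mul_of_nonneg_left (key q) (hπ.nonneg q)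
  have h3 : ∑ q, π q * R q = N * Real.exp (-(D ^ 2 / (32 * N))) +
      N * ((∑ q, π q * Real.exp (ε / 16 * idle (fast μ) q)) *
        Real.exp (-(ε / 16 * (D / (4 * m))))) := by
    rw [← mul_one (N * Real.exp (-(D ^ 2 / (32 * N)))), ← hπ.sum_eq_one, Finset.mul_sum,
      Finset.sum_mul, Finset.mul_sum, ← Finset.sum_add_distrib]
    exact Finset.sum_congr rfl fun q _ => by simp only [hR]; ring
  rw [h3] at h2
  refine h2.trans ?_
  gcongr

end

/-! ### Polynomial test functions: the Super-Halfin–Whitt bound -/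

section

variable {N b : ℕ} {α ε : ℝ} {μ : Fin N → ℝ} {π : State N b → ℝ}

/-- I falls at rate λN when positive and rises at the single-job rate N - Z - `queueRate`. The
product I · `queueRate` is what is needed later to control YI. -/
theorem generator_sq_idle_le [NeZero N] (hb : 1 ≤ b) (hL : 0 ≤ load N α * N)
    (hμ : ∀ n, 0 ≤ μ n) (htot : ∑ n, μ n = N) (hLN : load N α * N ≤ N) (q : State N b) :
    generator α μ (fun q => idle Finset.univ q ^ 2 / 2) q ≤
      idle Finset.univ q * (N - load N α * N - idleRate μ q - queueRate μ q) + N := by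
  have hsum := idleRate_add_singleRate_add_queueRate μ q
  rw [htot] at hsum
  have hB1 := singleRate_nonneg hμ Finset.univ q
  have hB2 := queueRate_nonneg hμ q
  have hZ := idleRate_nonneg hμ q
  have hd1 : ∀ n, (q n : ℕ) = 1 →
      idle Finset.univ (depart q n) ^ 2 / 2 - idle Finset.univ q ^ 2 / 2 ≤
        idle Finset.univ q + 1 / 2 := by
    intro n hn
    rw [idle_depart _ _ _ hn.ge]
    simp only [hn, Finset.mem_univ, and_self, if_true]
    linarith
  have hd2 : ∀ n, 2 ≤ (q n : ℕ) →
      idle Finset.univ (depart q n) ^ 2 / 2 - idle Finset.univ q ^ 2 / 2 ≤ 0 := by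
    intro n hn
    rw [idle_depart _ _ _ (by omega)]
    have h1 : (q n : ℕ) ≠ 1 := by omega
    simp [h1]
  have hS : singleRate μ Finset.univ q = N - idleRate μ q - queueRate μ q := by linarith
  by_cases hI : idle Finset.univ q = 0
  · refine (generator_le (a := 0) hL hμ Finset.univ (fun n _ => ?_) (fun n _ => hd1 n)
      (by simp) hd2).trans ?_
    · have hn := (idle_eq_zero_iff _ _).mp hI n (Finset.mem_univ n)
      have h2 : ¬(n ∈ Finset.univ ∧ (q n : ℕ) = 0) := fun h => by omega
      rw [idle_arrive hb, if_neg h2]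
      simp
    · rw [hI, hS]
      linarith
  · refine (generator_le (a := -idle Finset.univ q + 1 / 2) hL hμ Finset.univ
      (fun n hn => ?_) (fun n _ => hd1 n) (by simp) hd2).trans ?_
    · have hn0 := eq_zero_of_mem_targets hn hI
      rw [idle_arrive hb]
      simp only [hn0, Finset.mem_univ, and_self, if_true]
      linarith
    · rw [hS]
      linarith

/-- Y - I is the number of jobs minus N, so accepted arrivals and departures change it by exactly
±1. -/
theorem generator_sq_waiting_sub_idle_le [NeZero N] (hb : 2 ≤ b) (hL : 0 ≤ load N α * N)
    (hμ : ∀ n, 0 ≤ μ n) (htot : ∑ n, μ n = N) (hLN : load N α * N ≤ N) (q : State N b) :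
    generator α μ (fun q => (waiting q - idle Finset.univ q) ^ 2 / 2) q ≤
      (waiting q - idle Finset.univ q) * (idleRate μ q - (N - load N α * N)) + N := by
  have hsum := idleRate_add_singleRate_add_queueRate μ q
  rw [htot] at hsum
  have hZ := idleRate_nonneg hμ q
  set X := waiting q - idle Finset.univ q with hX
  have hd : ∀ n, 1 ≤ (q n : ℕ) →
      (waiting (depart q n) - idle Finset.univ (depart q n)) ^ 2 / 2 - X ^ 2 / 2 ≤ -X + 1 / 2 := by
    intro n hn
    have : waiting (depart q n) - idle Finset.univ (depart q n) = X - 1 := by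
      rw [waiting_depart, idle_depart _ _ _ hn]
      rcases hn.lt_or_eq with h | h
      · have h1 : (q n : ℕ) ≠ 1 := by omega
        have h2 : 2 ≤ (q n : ℕ) := h
        simp [h1, h2, hX]; ring
      · simp [← h, hX]; ring
    rw [this]
    linarith
  have hfin : load N α * N * (X + 1 / 2) + (singleRate μ Finset.univ q * (-X + 1 / 2) +
      queueRate μ q * (-X + 1 / 2)) ≤ X * (idleRate μ q - (N - load N α * N)) + N := by
    rw [← add_mul, show singleRate μ Finset.univ q + queueRate μ q = N - idleRate μ q by linarith]
    linarith
  refine (generator_le (a := X + 1 / 2) (d₁ := -X + 1 / 2) (d₂ := -X + 1 / 2) hL hμ Finset.univ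
    (fun n hn => ?_) (fun n _ h => hd n h.ge) (by simp) (fun n h => hd n (by omega))).trans hfin
  show (waiting (arrive q n) - idle Finset.univ (arrive q n)) ^ 2 / 2 - X ^ 2 / 2 ≤ _
  have hlt := Nat.le_of_lt_succ (q n).isLt
  rw [waiting_arrive, idle_arrive (by omega)]
  by_cases h0 : (q n : ℕ) = 0
  · simp [h0]
    rw [show waiting q - (idle Finset.univ q - 1) = X + 1 by rw [hX]; ring]
    linarith
  · have h1 : 1 ≤ (q n : ℕ) := by omega
    rcases hlt.lt_or_eq with h | h
    · simp [h0, h1, h]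
      rw [show waiting q + 1 - idle Finset.univ q = X + 1 by rw [hX]; ring]
      linarith
    · have hI : idle Finset.univ q = 0 := by
        rw [idle_eq_zero_iff]
        intro m _
        have : (q n : ℕ) ≤ q m := le_of_mem_targets hn m
        omega
      have hX0 : 0 ≤ X := by rw [hX, hI, sub_zero]; exact waiting_nonneg q
      simp [h]
      rw [if_neg (by omega)]
      rw [show waiting q - (idle Finset.univ q - 0) = X by rw [hX]; ring]
      linarith

/-- When I_F > 0 an arrival takes an idle fast server and leaves Y alone; when I_F = 0 the function
vanishes whatever Y becomes. Departures from queues only lower Y, so the negative drift of I_F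
carries over with weight Y, giving (ε/4) E[Y I_F] ≤ E[Y]. -/
theorem generator_waiting_mul_sq_idle_fast_le [NeZero N] (hb : 1 ≤ b)
    (hμ : ∀ n, 0 ≤ μ n) (hLN : load N α * N ≤ N) (hε : 0 < ε)
    (hF : ∑ n ∈ fast μ, μ n + ε * N / 4 ≤ load N α * N) (q : State N b) :
    generator α μ (fun q => waiting q * idle (fast μ) q ^ 2 / 2) q ≤
      N * (waiting q - ε / 4 * (waiting q * idle (fast μ) q)) := by
  have hN : (0 : ℝ) < N := by exact_mod_cast NeZero.pos N
  have hS0 : 0 ≤ ∑ n ∈ fast μ, μ n := Finset.sum_nonneg fun n _ => hμ n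
  have hL : 0 ≤ load N α * N := by nlinarith
  have hB1 := singleRate_le hμ (fast μ) q
  have hY := waiting_nonneg q
  have hI0 := idle_nonneg (fast μ) q
  have hd1 : ∀ n ∈ fast μ, (q n : ℕ) = 1 →
      waiting (depart q n) * idle (fast μ) (depart q n) ^ 2 / 2 -
        waiting q * idle (fast μ) q ^ 2 / 2 ≤ waiting q * (idle (fast μ) q + 1 / 2) := by
    intro n hn h1
    rw [waiting_depart, idle_depart _ _ _ h1.ge]
    simp only [hn, h1, and_self, if_true]
    norm_num
    linarith
  have hd1' : ∀ n ∉ fast μ, (q n : ℕ) = 1 →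
      waiting (depart q n) * idle (fast μ) (depart q n) ^ 2 / 2 -
        waiting q * idle (fast μ) q ^ 2 / 2 ≤ 0 := by
    intro n hn h1
    rw [waiting_depart, idle_depart _ _ _ h1.ge]
    simp [hn, h1]
  have hd2 : ∀ n, 2 ≤ (q n : ℕ) →
      waiting (depart q n) * idle (fast μ) (depart q n) ^ 2 / 2 -
        waiting q * idle (fast μ) q ^ 2 / 2 ≤ 0 := by
    intro n hn
    rw [waiting_depart, idle_depart _ _ _ (by omega)]
    have h1 : (q n : ℕ) ≠ 1 := by omega
    simp only [h1, hn, and_false, if_false, if_true, add_zero]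
    nlinarith [sq_nonneg (idle (fast μ) q)]
  have hs : singleRate μ (fast μ) q * (waiting q * (idle (fast μ) q + 1 / 2)) ≤
      (∑ n ∈ fast μ, μ n) * (waiting q * (idle (fast μ) q + 1 / 2)) :=
    mul_le_mul_of_nonneg_right hB1 (by positivity)
  by_cases hI : idle (fast μ) q = 0
  · refine (generator_le (a := 0) hL hμ (fast μ) (fun n _ => ?_) hd1 hd1' hd2).trans ?_
    · have : ¬(n ∈ fast μ ∧ (q n : ℕ) = 0) := fun h => by
        have := (idle_eq_zero_iff _ _).mp hI n h.1; omega
      rw [idle_arrive hb, if_neg this, hI]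
      simp
    · rw [hI] at hs ⊢
      have hSN : ∑ n ∈ fast μ, μ n ≤ N := by nlinarith [mul_pos hε hN]
      have := mul_le_mul_of_nonneg_right hSN hY
      have := mul_nonneg hN.le hY
      linarith
  · refine (generator_le (a := waiting q * (-idle (fast μ) q + 1 / 2)) hL hμ (fast μ)
      (fun n hn => ?_) hd1 hd1' hd2).trans ?_
    · have h1 := mem_fast_of_mem_targets hn hI
      have h2 := eq_zero_of_mem_targets hn (idle_univ_ne_zero hI)
      rw [waiting_arrive, idle_arrive hb]
      simp only [h1, h2, and_self, if_true]
      norm_num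
      linarith
    · have h3 := mul_le_mul_of_nonneg_right hF (mul_nonneg hY hI0)
      have h4 : (load N α * N + ∑ n ∈ fast μ, μ n) * waiting q ≤ 2 * N * waiting q :=
        mul_le_mul_of_nonneg_right (by nlinarith) hY
      linarith

/-- The factor 2 pays for blocking: if all servers are full then `queueRate` is N ≥ λN, and the
spare copy covers the lost arrivals. -/
theorem generator_neg_waiting_le [NeZero N] (hb : 2 ≤ b) (hL : 0 ≤ load N α * N)
    (hμ : ∀ n, 0 ≤ μ n) (htot : ∑ n, μ n = N) (hLN : load N α * N ≤ N) (q : State N b) :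
    generator α μ (fun q => -waiting q) q ≤
      2 * queueRate μ q - load N α * N * (if idle Finset.univ q = 0 then 1 else 0) := by
  have hB2 := queueRate_nonneg hμ q
  have hd1 : ∀ n, (q n : ℕ) = 1 → -waiting (depart q n) - -waiting q ≤ 0 := by
    intro n hn
    rw [waiting_depart]
    simp [hn]
  have hd2 : ∀ n, 2 ≤ (q n : ℕ) → -waiting (depart q n) - -waiting q ≤ 1 := by
    intro n hn
    rw [waiting_depart]
    simp [hn]
  by_cases h : idle Finset.univ q = 0 ∧ ∃ m, (q m : ℕ) < b
  · rw [if_pos h.1]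
    refine (generator_le (a := -1) hL hμ Finset.univ (fun n hn => ?_) (fun n _ => hd1 n)
      (by simp) hd2).trans (by linarith)
    obtain ⟨m, hm⟩ := h.2
    have h1 := (idle_eq_zero_iff _ _).mp h.1 n (Finset.mem_univ n)
    have h2 : (q n : ℕ) ≤ q m := le_of_mem_targets hn m
    rw [waiting_arrive, if_pos ⟨h1, by omega⟩]
    linarith
  · have hle : queueRate μ q ≤
        2 * queueRate μ q - load N α * N * (if idle Finset.univ q = 0 then 1 else 0) := by
      split_ifs with hI
      · have h2 : ∀ m, b ≤ (q m : ℕ) := by simpa [hI] using h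
        have : queueRate μ q = N := by
          rw [← htot]
          exact Finset.sum_congr rfl fun n _ => if_pos (hb.trans (h2 n))
        linarith
      · linarith
    refine (generator_le (a := 0) hL hμ Finset.univ (fun n hn => ?_) (fun n _ => hd1 n)
      (by simp) hd2).trans (by linarith)
    rw [waiting_arrive]
    split_ifs <;> linarith

theorem load_mul_waitProb_le [NeZero N] (hb : 2 ≤ b) (hL : 0 ≤ load N α * N)
    (hμ : ∀ n, 0 ≤ μ n) {m : ℝ} (hm : ∀ n, μ n ≤ m) (htot : ∑ n, μ n = N)
    (hLN : load N α * N ≤ N) (hπ : IsStationary α μ π) :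
    load N α * N * waitProb μ π ≤ 2 * m * ∑ q, π q * waiting q := by
  have h := hπ.sum_nonneg_of_generator_le _ _ (generator_neg_waiting_le hb hL hμ htot hLN)
  have hm0 : 0 ≤ m := (hμ 0).trans (hm 0)
  have h2 : ∑ q, π q * (2 * queueRate μ q -
      load N α * N * (if idle Finset.univ q = 0 then 1 else 0)) ≤
      2 * m * ∑ q, π q * waiting q - load N α * N * waitProb μ π := by
    rw [waitProb_eq, Finset.mul_sum, Finset.mul_sum, ← Finset.sum_sub_distrib]
    refine Finset.sum_le_sum fun q _ => ?_
    have := mul_le_mul_of_nonneg_left (queueRate_le hm hm0 q) (hπ.nonneg q)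
    linarith
  linarith

/-- Compares the drifts of `idle ^ 2`, of `(waiting - idle) ^ 2` and of
`waiting * idle (fast μ) ^ 2`. -/
theorem expect_waiting_le [NeZero N] (hb : 2 ≤ b) (hε : 0 < ε) (hε1 : ε ≤ 1)
    (hμ : ∀ n, ε ≤ μ n) {m : ℝ} (hm : ∀ n, μ n ≤ m) (htot : ∑ n, μ n = N)
    (hL : 0 ≤ load N α * N) (hF : ∑ n ∈ fast μ, μ n + ε * N / 4 ≤ load N α * N)
    (hπ : IsStationary α μ π) {D : ℝ} (hD : D = N - load N α * N) (hD0 : 0 < D)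
    (hD2 : D ^ 2 ≤ N) (hmD : 4 * m / ε ≤ D / 2) :
    D * ∑ q, π q * waiting q ≤ 12 * b * N / ε ^ 2 := by
  have hN : (0 : ℝ) < N := by exact_mod_cast NeZero.pos N
  have hμ0 : ∀ n, 0 ≤ μ n := fun n => hε.le.trans (hμ n)
  have hm0 : 0 ≤ m := (hμ0 0).trans (hm 0)
  have hb' : (2 : ℝ) ≤ b := by exact_mod_cast hb
  have hLN : load N α * N ≤ N := by linarith
  have g1 := hπ.sum_nonneg_of_generator_le _ _
    (generator_sq_idle_le (by omega) hL hμ0 htot hLN)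
  have g2 := hπ.sum_nonneg_of_generator_le _ _
    (generator_sq_waiting_sub_idle_le hb hL hμ0 htot hLN)
  have g3 := hπ.sum_nonneg_of_generator_le _ _
    (generator_waiting_mul_sq_idle_fast_le (by omega) hμ0 hLN hε hF)
  rw [← hD] at g1 g2
  set EY := ∑ q, π q * waiting q with hEY
  set EIB := ∑ q, π q * (idle Finset.univ q * queueRate μ q) with hEIB
  set EYF := ∑ q, π q * (waiting q * idle (fast μ) q) with hEYF
  have hN1 : ∑ q, π q * N = N := by rw [← Finset.sum_mul, hπ.sum_eq_one, one_mul]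
  have hN2 : ∑ q, π q * (N / (4 * ε)) = N / (4 * ε) := by
    rw [← Finset.sum_mul, hπ.sum_eq_one, one_mul]
  -- Z ≥ εI and completing the square give I(D - Z) ≤ D²/(4ε); this is where D² ≤ N enters.
  have quad : ∀ q : State N b,
      idle Finset.univ q * (D - idleRate μ q) ≤ N / (4 * ε) := by
    intro q
    have h1 := mul_idle_le_idleRate hμ q
    have h2 := idle_nonneg Finset.univ q
    rw [le_div_iff₀ (by positivity)]
    have h3 : idle Finset.univ q * (D - idleRate μ q) ≤
        idle Finset.univ q * (D - ε * idle Finset.univ q) :=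
      mul_le_mul_of_nonneg_left (by linarith) h2
    have h4 := mul_le_mul_of_nonneg_right h3 (by positivity : 0 ≤ 4 * ε)
    nlinarith [sq_nonneg (D - 2 * ε * idle Finset.univ q)]
  have h1 : EIB ≤ N / (4 * ε) + N := by
    have : ∑ q, π q * (idle Finset.univ q * (D - idleRate μ q - queueRate μ q) + N) ≤
        ∑ q, π q * (N / (4 * ε)) - EIB + ∑ q, π q * N := by
      rw [hEIB, ← Finset.sum_sub_distrib, ← Finset.sum_add_distrib]
      refine Finset.sum_le_sum fun q _ => ?_
      have := mul_le_mul_of_nonneg_left (quad q) (hπ.nonneg q)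
      linarith
    rw [hN1, hN2] at this
    linarith
  have h3 : ε / 4 * EYF ≤ EY := by
    have : ∑ q, π q * (N * (waiting q - ε / 4 * (waiting q * idle (fast μ) q))) =
        N * (EY - ε / 4 * EYF) := by
      rw [hEY, hEYF, mul_sub, Finset.mul_sum, Finset.mul_sum, Finset.mul_sum,
        ← Finset.sum_sub_distrib]
      exact Finset.sum_congr rfl fun q _ => by ring
    rw [this] at g3
    have := nonneg_of_mul_nonneg_right g3 hN
    linarith
  -- Expand (Y - I)(Z - D): in YZ ≤ 2YI + m Y I_F the first product is controlled by εY ≤ b ·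
  -- `queueRate`, and I(D - Z) by `quad`.
  have h2 : ε * D * EY ≤ 2 * b * EIB + ε * m * EYF + ε * (N / (4 * ε) + N) := by
    have : ∑ q, π q * ((waiting q - idle Finset.univ q) * (idleRate μ q - D) + N) * ε ≤
        2 * b * EIB + ε * m * EYF + ε * ∑ q, π q * (N / (4 * ε)) + ε * ∑ q, π q * N
          - ε * D * EY := by
      rw [hEIB, hEYF, hEY, Finset.mul_sum, Finset.mul_sum, Finset.mul_sum, Finset.mul_sum,
        Finset.mul_sum, ← Finset.sum_add_distrib, ← Finset.sum_add_distrib,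
        ← Finset.sum_add_distrib, ← Finset.sum_sub_distrib]
      refine Finset.sum_le_sum fun q _ => ?_
      have hY := waiting_nonneg q
      have hI := idle_nonneg Finset.univ q
      have a1 := mul_le_mul_of_nonneg_left (quad q) hε.le
      have a2 := mul_le_mul_of_nonneg_left (idleRate_le hm q) (mul_nonneg hε.le hY)
      have a3 := mul_le_mul_of_nonneg_right (mul_waiting_le hε hμ q) hI
      have : ((waiting q - idle Finset.univ q) * (idleRate μ q - D) + N) * ε ≤
          2 * b * (idle Finset.univ q * queueRate μ q) + ε * m * (waiting q * idle (fast μ) q) +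
            ε * (N / (4 * ε)) + ε * N - ε * D * waiting q := by
        linarith
      have := mul_le_mul_of_nonneg_left this (hπ.nonneg q)
      linarith
    rw [hN1, hN2, ← Finset.sum_mul] at this
    have := (mul_nonneg g2 hε.le).trans this
    linarith
  have hEY0 : 0 ≤ EY := Finset.sum_nonneg fun q _ => mul_nonneg (hπ.nonneg q) (waiting_nonneg q)
  -- Since 4m/ε ≤ D/2, the fast-server term is absorbed into half of the left side.
  have h4 : ε * m * EYF ≤ ε * (D / 2) * EY := by
    have h5 : m ≤ D / 2 * (ε / 4) := by
      rw [div_le_iff₀ hε] at hmD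
      linarith
    have h6 := mul_le_mul_of_nonneg_left h3 (by positivity : 0 ≤ 4 * m)
    have h7 := mul_le_mul_of_nonneg_right h5 hEY0
    linarith
  have h8 : N / (4 * ε) ≤ N / ε := by
    gcongr; linarith
  have h9 : (N : ℝ) ≤ N / ε := by
    rw [le_div_iff₀ hε]; nlinarith
  have hNe : (0 : ℝ) < N / ε := by positivity
  have h10 : ε * D * EY ≤ 12 * b * (N / ε) := by
    have h11 : 2 * b * EIB ≤ 2 * b * (2 * (N / ε)) :=
      mul_le_mul_of_nonneg_left (by linarith) (by positivity)
    have h12 : ε * (N / (4 * ε) + N) ≤ 1 * (2 * (N / ε)) :=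
      mul_le_mul hε1 (by linarith) (by positivity) (by norm_num)
    nlinarith
  rw [le_div_iff₀ (by positivity)]
  have h13 := mul_le_mul_of_nonneg_left h10 hε.le
  have h14 : ε * (12 * b * (N / ε)) = 12 * b * N := by field_simp
  linarith

end

/-! ### Consequences of the rate and regime conditions -/

section

variable {N b : ℕ} {α ε r : ℝ} {μ : Fin N → ℝ} {π : State N b → ℝ} {n₂ : Fin N}

theorem sub_load_mul [NeZero N] (α : ℝ) : N - load N α * N = (N : ℝ) ^ (1 - α) := by
  have hN : (0 : ℝ) < N := by exact_mod_cast NeZero.pos N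
  rw [load, sub_eq_add_neg 1 α, Real.rpow_add hN, Real.rpow_one]
  ring

theorem Rates.le_one [NeZero N] (h : Rates α ε μ n₂) : ε ≤ 1 := by
  have hN : (0 : ℝ) < N := by exact_mod_cast NeZero.pos N
  have h1 : ∑ _n : Fin N, ε ≤ ∑ n, μ n := Finset.sum_le_sum fun n _ => h.lower n
  rw [h.total, Finset.sum_const, Finset.card_univ, Fintype.card_fin, nsmul_eq_mul] at h1
  nlinarith

/-- If S is the fast total, at most S/2 servers are fast, so the others carry N - S ≥ ε(N - S/2).
This gives S ≤ N(1 - ε/2), while λN ≥ N(1 - ε/4). -/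
theorem Rates.sum_fast_add_le [NeZero N] (h : Rates α ε μ n₂) (hε : 0 < ε)
    (hα : (N : ℝ) ^ (-α) ≤ ε / 4) : ∑ n ∈ fast μ, μ n + ε * N / 4 ≤ load N α * N := by
  have hN : (0 : ℝ) < N := by exact_mod_cast NeZero.pos N
  have hsplit := Finset.sum_filter_add_sum_filter_not Finset.univ (fun n => 2 < μ n) μ
  have hcard := Finset.card_filter_add_card_filter_not (s := (Finset.univ : Finset (Fin N)))
    (fun n => 2 < μ n)
  rw [Finset.card_univ, Fintype.card_fin] at hcard
  have hcard' : ((fast μ).card : ℝ) +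
      ((Finset.univ.filter fun n => ¬ 2 < μ n).card : ℝ) = N := by exact_mod_cast hcard
  have h1 : ((fast μ).card : ℝ) * 2 ≤ ∑ n ∈ fast μ, μ n := by
    rw [← nsmul_eq_mul]
    exact Finset.card_nsmul_le_sum _ _ _ fun n hn => (Finset.mem_filter.mp hn).2.le
  have h2 : ((Finset.univ.filter fun n => ¬ 2 < μ n).card : ℝ) * ε ≤
      ∑ n ∈ Finset.univ.filter (fun n => ¬ 2 < μ n), μ n := by
    rw [← nsmul_eq_mul]
    exact Finset.card_nsmul_le_sum _ _ _ fun n _ => h.lower n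
  have h3 : 0 ≤ ∑ n ∈ Finset.univ.filter (fun n => ¬ 2 < μ n), μ n :=
    Finset.sum_nonneg fun n _ => hε.le.trans (h.lower n)
  rw [h.total] at hsplit
  change ∑ n ∈ fast μ, μ n + _ = _ at hsplit
  have h4 : (N : ℝ) ^ (-α) * N ≤ ε / 4 * N := mul_le_mul_of_nonneg_right hα hN.le
  rw [load]
  nlinarith

theorem Rates.le_zero [NeZero N] (h : Rates α ε μ n₂) (n : Fin N) : μ n ≤ μ 0 :=
  h.antitone (Fin.zero_le n)

theorem sub_waitProb_le [NeZero N] (hb : 2 ≤ b) (hε : 0 < ε) (hR : Rates α ε μ n₂)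
    (hπ : IsStationary α μ π) (hA : SubAssumption N b α r ε (μ 0))
    (hα : (N : ℝ) ^ (-α) ≤ ε / 4) (hlog : 3 ≤ Real.log N) {δ : ℝ}
    (h₁ : (N : ℝ) ^ (3 / 2 : ℝ) * Real.exp (-((N : ℝ) ^ (1 - 2 * α) / 32)) ≤ δ / 4)
    (h₂ : 24 / ε * (N : ℝ) ^ (-(3 / 2) : ℝ) ≤ δ / 4) :
    waitProb μ π ≤ δ / Real.sqrt N := by
  have hN1 : (1 : ℝ) ≤ N := by exact_mod_cast NeZero.pos N
  have hN : (0 : ℝ) < N := by linarith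
  have hF := hR.sum_fast_add_le hε hα
  have hμ0 : ∀ n, 0 ≤ μ n := fun n => hε.le.trans (hR.lower n)
  have hm : 0 < μ 0 := hε.trans_le (hR.lower 0)
  have hL : 0 ≤ load N α * N := by
    have := Finset.sum_nonneg (s := fast μ) fun n _ => hμ0 n
    have : 0 ≤ ε * N / 4 := by positivity
    linarith
  have hD := sub_load_mul (N := N) α
  have hD1 : (1 : ℝ) ≤ (N : ℝ) ^ (1 - α) :=
    Real.one_le_rpow hN1 (by have := hA.regime.2; linarith)
  have h := waitProb_mul_le_exp (by omega : 1 ≤ b) hε hR.le_one hR.lower hR.le_zero hR.total hL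
    (by linarith) hF hπ hD.symm
  have hDsq : ((N : ℝ) ^ (1 - α)) ^ 2 / (32 * N) = (N : ℝ) ^ (1 - 2 * α) / 32 := by
    have : ((N : ℝ) ^ (1 - α)) ^ 2 = (N : ℝ) ^ (1 - 2 * α) * N := by
      rw [← Real.rpow_natCast, ← Real.rpow_mul hN.le]
      nth_rewrite 3 [← Real.rpow_one (N : ℝ)]
      rw [← Real.rpow_add hN]
      congr 1
      push_cast
      ring
    rw [this]
    field_simp
  rw [hDsq] at h
  have hx : Real.exp (-(ε / 16 * ((N : ℝ) ^ (1 - α) / (4 * μ 0)))) ≤ (N : ℝ) ^ (-3 : ℝ) := by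
    rw [Real.rpow_def_of_pos hN (-3), Real.exp_le_exp]
    have hf := hA.fastest
    have hb' : (2 : ℝ) ≤ b := by exact_mod_cast hb
    rw [div_le_div_iff₀ (by positivity) (by positivity)] at hf
    -- The condition on μ₁/ε² makes the exponent εD/(64μ₁) at least 3 log N; the power N^(-3)
    -- outweighs the prefactor N and the √N of the claim.
    have h3 : Real.log N * 3 ≤ ε / 16 * ((N : ℝ) ^ (1 - α) / (4 * μ 0)) := by
      rw [← mul_div_assoc, le_div_iff₀ (by positivity)]
      have h4 : Real.log N * 3 ≤ b * (2 * Real.log N ^ 2 + 3) := by nlinarith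
      have h5 : μ 0 * (64 * (Real.log N * 3)) ≤ (N : ℝ) ^ (1 - α) * ε ^ 2 := by
        refine le_trans ?_ hf
        rw [mul_assoc (64 : ℝ)]
        gcongr
      have h6 : (N : ℝ) ^ (1 - α) * ε ^ 2 ≤ (N : ℝ) ^ (1 - α) * ε := by
        gcongr
        nlinarith [hA.upper]
      linarith
    linarith
  have hs : (N : ℝ) ^ (3 / 2 : ℝ) = N * Real.sqrt N := by
    rw [Real.sqrt_eq_rpow]
    nth_rewrite 2 [← Real.rpow_one (N : ℝ)]
    rw [← Real.rpow_add hN]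
    norm_num
  have hs' : (N : ℝ) ^ (-(3 / 2) : ℝ) = N * Real.sqrt N * (N : ℝ) ^ (-3 : ℝ) := by
    rw [← hs, ← Real.rpow_add hN]
    norm_num
  have hsq : 0 < Real.sqrt N := Real.sqrt_pos.mpr hN
  have hp : 0 ≤ waitProb μ π := by
    rw [waitProb_eq]
    exact Finset.sum_nonneg fun q _ => mul_nonneg (hπ.nonneg q) (by split_ifs <;> norm_num)
  rw [le_div_iff₀ hsq]
  -- The factor D ≥ 1 is given away; after multiplication by √N the two error terms sum to at most
  -- δ/2 ≤ (3/4)δ.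
  have h7 : 3 / 4 * waitProb μ π ≤ 3 / 4 * (N : ℝ) ^ (1 - α) * waitProb μ π := by nlinarith
  have h8 : 24 / ε * Real.exp (-(ε / 16 * ((N : ℝ) ^ (1 - α) / (4 * μ 0)))) ≤
      24 / ε * (N : ℝ) ^ (-3 : ℝ) := mul_le_mul_of_nonneg_left hx (by positivity)
  have h9 := mul_le_mul_of_nonneg_left h8 hN.le
  have h10 := mul_le_mul_of_nonneg_right (h7.trans (h.trans (add_le_add_right h9 _))) hsq.le
  rw [hs] at h₁
  rw [hs'] at h₂
  have hδ : 0 ≤ δ := by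
    have : 0 ≤ N * Real.sqrt N * Real.exp (-((N : ℝ) ^ (1 - 2 * α) / 32)) := by positivity
    linarith
  linarith

theorem super_waitProb_le [NeZero N] (hb : 2 ≤ b) (hr : 0 < r) (hε : 0 < ε)
    (hR : Rates α ε μ n₂) (hπ : IsStationary α μ π) (hA : SuperAssumption N b α r ε (μ 0))
    (hα : (N : ℝ) ^ (-α) ≤ ε / 4) (hlog : 1 ≤ Real.log N) (hlog' : 8 ≤ 24 * r * b * Real.log N) :
    waitProb μ π ≤ 48 * b * μ 0 / (ε ^ 2 * (N : ℝ) ^ (1 - α)) := by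
  have hN1 : (1 : ℝ) ≤ N := by exact_mod_cast NeZero.pos N
  have hN : (0 : ℝ) < N := by linarith
  have hF := hR.sum_fast_add_le hε hα
  have hμ0 : ∀ n, 0 ≤ μ n := fun n => hε.le.trans (hR.lower n)
  have hm : 0 < μ 0 := hε.trans_le (hR.lower 0)
  have hε1 := hR.le_one
  have hL : N / 2 ≤ load N α * N := by
    rw [load]
    nlinarith
  have hD := sub_load_mul (N := N) α
  have hD0 : (0 : ℝ) < (N : ℝ) ^ (1 - α) := Real.rpow_pos_of_pos hN _
  have hD2 : ((N : ℝ) ^ (1 - α)) ^ 2 ≤ N := by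
    rw [← Real.rpow_natCast, ← Real.rpow_mul hN.le]
    nth_rewrite 2 [← Real.rpow_one (N : ℝ)]
    exact Real.rpow_le_rpow_of_exponent_le hN1 (by have := hA.regime.1; push_cast; linarith)
  have hmD : 4 * μ 0 / ε ≤ (N : ℝ) ^ (1 - α) / 2 := by
    have hb0 : (0 : ℝ) < b := by exact_mod_cast (by omega : 0 < b)
    have h8 : 8 ≤ 24 * r * b * Real.log N ^ 2 := by
      refine hlog'.trans (mul_le_mul_of_nonneg_left ?_ (by positivity))
      nlinarith
    have : (N : ℝ) ^ (1 - α) / (24 * r * b * Real.log N ^ 2) ≤ (N : ℝ) ^ (1 - α) / 8 := by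
      gcongr
    have := hA.fastest.trans this
    rw [mul_div_assoc]
    linarith
  have hY := expect_waiting_le hb hε hε1 hR.lower hR.le_zero hR.total (by linarith) hF hπ hD.symm
    hD0 hD2 hmD
  have hW := load_mul_waitProb_le hb (by linarith : 0 ≤ load N α * N) hμ0 hR.le_zero hR.total
    (by linarith) hπ
  have hp : 0 ≤ waitProb μ π := by
    rw [waitProb_eq]
    exact Finset.sum_nonneg fun q _ => mul_nonneg (hπ.nonneg q) (by split_ifs <;> norm_num)
  rw [le_div_iff₀ (by positivity)]
  rw [le_div_iff₀ (by positivity)] at hY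
  have h1 : N / 2 * waitProb μ π ≤ 2 * μ 0 * ∑ q, π q * waiting q :=
    (mul_le_mul_of_nonneg_right hL hp).trans hW
  have h2 := mul_le_mul_of_nonneg_right h1 (by positivity : 0 ≤ ε ^ 2 * (N : ℝ) ^ (1 - α))
  have h3 := mul_le_mul_of_nonneg_left hY (by positivity : 0 ≤ 2 * μ 0)
  refine le_of_mul_le_mul_left ?_ (by positivity : (0 : ℝ) < N / 2)
  linarith

/-- One factor log N absorbs the surplus b/(rε²) in the bound on p_W and in the passage to E[W]; b ≥
2 gives b ≤ 2(b - 1). -/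
theorem mul_le_kSuper_mul_div {m D l : ℝ} (hb : (2 : ℝ) ≤ b) (hr : 0 < r) (hε : 0 < ε)
    (hm : 0 ≤ m) (hD : 0 < D) (h : 8 * b ≤ ε ^ 2 * (r * l)) :
    2 * b / ε * (48 * b * m / (ε ^ 2 * D)) ≤ kSuper b r ε m * l / D := by
  have e1 : 2 * b / ε * (48 * b * m / (ε ^ 2 * D)) = (96 * b * b / ε ^ 2) * (m / (ε * D)) := by
    field_simp
    ring
  have e2 : kSuper b r ε m * l / D = (24 * r * (b - 1) * l) * (m / (ε * D)) := by
    rw [kSuper]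
    field_simp
  rw [e1, e2]
  refine mul_le_mul_of_nonneg_right ?_ (by positivity)
  rw [div_le_iff₀ (by positivity)]
  have h1 := mul_le_mul_of_nonneg_left h (by linarith : (0 : ℝ) ≤ b - 1)
  nlinarith

/-- In the variable x = N^(1-2α), which tends to infinity, this is a power of x times exp(-x/32). -/
theorem eventually_rpow_mul_exp_le (hα : α < 1 / 2) {c : ℝ} (hc : 0 < c) :
    ∀ᶠ N : ℕ in Filter.atTop,
      (N : ℝ) ^ (3 / 2 : ℝ) * Real.exp (-((N : ℝ) ^ (1 - 2 * α) / 32)) ≤ c := by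
  have hβ : 0 < 1 - 2 * α := by linarith
  have h := ((tendsto_rpow_mul_exp_neg_mul_atTop_nhds_zero (3 / 2 / (1 - 2 * α)) (1 / 32)
    (by norm_num)).comp (tendsto_rpow_atTop hβ)).comp (tendsto_natCast_atTop_atTop (R := ℝ))
  filter_upwards [h.eventually_le_const hc] with N hN
  refine le_of_eq_of_le ?_ hN
  simp only [Function.comp]
  rw [← Real.rpow_mul (Nat.cast_nonneg _), mul_div_cancel₀ _ hβ.ne']
  ring_nf

end

end JFSQ

end

/-! ### Choice of N₀ and conclusion -/

theorem theorem1 (r : ℝ) (hr : 0 < r) :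
    ∃ C : ℝ, 0 < C ∧
      ∀ (α : ℝ) (b : ℕ) (ε : ℝ), 0 < α → α < 1 → 2 ≤ b → 0 < ε →
        ∃ N₀ : ℕ, ∀ (N : ℕ) [NeZero N], N₀ ≤ N →
          ∀ (μ : Fin N → ℝ) (n₂ : Fin N) (π : JFSQ.State N b → ℝ),
            JFSQ.Rates α ε μ n₂ → JFSQ.IsStationary α μ π →
              (JFSQ.SubAssumption N b α r ε (μ 0) →
                JFSQ.blockProb μ π < 1 ∧
                MeasureTheory.Integrable (fun w : ℝ => w) (JFSQ.waitLaw μ π) ∧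
                ∫ w, w ∂(JFSQ.waitLaw μ π) ≤
                  C * (1 / (N : ℝ) ^ α + JFSQ.kSub b ε (μ n₂) / (N : ℝ) ^ (1 - α)) ∧
                JFSQ.waitProb μ π ≤
                  C * (JFSQ.kSub b ε (μ n₂) / (N : ℝ) ^ (1 - α) +
                    Real.log N / Real.sqrt N)) ∧
              (JFSQ.SuperAssumption N b α r ε (μ 0) →
                JFSQ.blockProb μ π < 1 ∧
                MeasureTheory.Integrable (fun w : ℝ => w) (JFSQ.waitLaw μ π) ∧
                ∫ w, w ∂(JFSQ.waitLaw μ π) ≤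
                  C * (JFSQ.kSuper b r ε (μ 0) * Real.log N / (N : ℝ) ^ (1 - α) +
                    Real.log N / Real.sqrt N) ∧
                JFSQ.waitProb μ π ≤
                  C * (JFSQ.kSuper b r ε (μ 0) * Real.log N / (N : ℝ) ^ (1 - α))) := by
  refine ⟨1, one_pos, fun α b ε hα0 hα1 hb hε => ?_⟩
  have hb' : (2 : ℝ) ≤ b := by exact_mod_cast hb
  have hcast := tendsto_natCast_atTop_atTop (R := ℝ)
  -- The first entry cancels the factor 2b/ε in E[W]; the second gives p_B ≤ p_W ≤ 1/2 and δ ≤ log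
  -- N.
  set δ := min (ε / (2 * b)) (1 / 2) with hδ
  have hδ0 : 0 < δ := by positivity
  have ev₁ : ∀ᶠ N : ℕ in Filter.atTop, (N : ℝ) ^ (-α) ≤ ε / 4 :=
    ((tendsto_rpow_neg_atTop hα0).comp hcast).eventually_le_const (by positivity)
  have ev₂ : ∀ᶠ N : ℕ in Filter.atTop, 3 ≤ Real.log N :=
    (Real.tendsto_log_atTop.comp hcast).eventually_ge_atTop 3
  have ev₃ : ∀ᶠ N : ℕ in Filter.atTop, 8 * b / (ε ^ 2 * r) ≤ Real.log N :=
    (Real.tendsto_log_atTop.comp hcast).eventually_ge_atTop _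
  have ev₄ : ∀ᶠ N : ℕ in Filter.atTop, (N : ℝ) ^ (-(3 / 2) : ℝ) ≤ δ / 4 / (24 / ε) :=
    ((tendsto_rpow_neg_atTop (by norm_num : (0 : ℝ) < 3 / 2)).comp hcast).eventually_le_const
      (by positivity)
  have ev₅ : ∀ᶠ N : ℕ in Filter.atTop, α < 1 / 2 →
      (N : ℝ) ^ (3 / 2 : ℝ) * Real.exp (-((N : ℝ) ^ (1 - 2 * α) / 32)) ≤ δ / 4 := by
    by_cases h : α < 1 / 2
    · filter_upwards [JFSQ.eventually_rpow_mul_exp_le h (by positivity : 0 < δ / 4)] with N hN _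
      exact hN
    · exact Filter.Eventually.of_forall fun N h' => absurd h' h
  obtain ⟨N₀, hN₀⟩ := Filter.eventually_atTop.mp
    (ev₁.and (ev₂.and (ev₃.and (ev₄.and ev₅))))
  refine ⟨N₀, fun N _ hN μ n₂ π hR hπ => ?_⟩
  obtain ⟨c₁, c₂, c₃, c₄, c₅⟩ := hN₀ N hN
  have hN1 : (1 : ℝ) ≤ N := by exact_mod_cast NeZero.pos N
  have hNpos : (0 : ℝ) < N := by linarith
  have hsq1 : 1 ≤ Real.sqrt N := Real.one_le_sqrt.mpr hN1
  have hsq : 0 < Real.sqrt N := by linarith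
  have hD0 : (0 : ℝ) < (N : ℝ) ^ (1 - α) := Real.rpow_pos_of_pos hNpos _
  have hpos : ∀ n, 0 < μ n := fun n => hε.trans_le (hR.lower n)
  have hB := JFSQ.blockProb_le_waitProb (by omega : 1 ≤ b) (μ := μ) hπ.nonneg
  have hε1 := hR.le_one
  simp only [one_mul]
  constructor
  · intro hA
    have hp := JFSQ.sub_waitProb_le hb hε hR hπ hA c₁ c₂ (c₅ hA.regime.2)
      (by rw [le_div_iff₀ (by positivity)] at c₄; linarith)
    -- Only the sign of the `kSub` term is needed: 1/√N ≤ N^(-α) bounds E[W], and (log N)/√N bounds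
    -- p_W.
    have hk : 0 ≤ JFSQ.kSub b ε (μ n₂) / (N : ℝ) ^ (1 - α) := by
      have := (hpos n₂).le
      have : (0 : ℝ) ≤ b - 1 := by linarith
      unfold JFSQ.kSub
      positivity
    have hhalf : JFSQ.waitProb μ π ≤ 1 / 2 := by
      refine hp.trans ((div_le_self hδ0.le hsq1).trans (min_le_right _ _))
    refine ⟨by linarith, JFSQ.integrable_waitLaw hpos π, ?_, ?_⟩
    · have hW := JFSQ.integral_waitLaw_le hε hR.lower hπ.nonneg (hB.trans hhalf)
      have h1 : 2 * b / ε * JFSQ.waitProb μ π ≤ 2 * b / ε * (ε / (2 * b) / Real.sqrt N) := by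
        gcongr
        exact hp.trans (by gcongr; exact min_le_left _ _)
      have h2 : 2 * b / ε * (ε / (2 * b) / Real.sqrt N) = 1 / Real.sqrt N := by
        field_simp
      have h3 : 1 / Real.sqrt N ≤ 1 / (N : ℝ) ^ α := by
        rw [Real.sqrt_eq_rpow]
        gcongr
        exact hA.regime.2.le
      linarith
    · have h1 : δ / Real.sqrt N ≤ Real.log N / Real.sqrt N := by
        gcongr
        linarith [min_le_right (ε / (2 * b)) (1 / 2)]
      linarith
  · intro hA
    have c₃' : 8 * b ≤ ε ^ 2 * (r * Real.log N) := by
      rw [div_le_iff₀ (by positivity)] at c₃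
      linarith
    have hεsq : ε ^ 2 ≤ ε := by nlinarith
    have hrl : 0 < r * Real.log N := by positivity
    have c₃'' : 8 * b ≤ ε * (r * Real.log N) := c₃'.trans (by gcongr)
    have c₃₁ : 8 * b ≤ r * Real.log N := c₃''.trans (by nlinarith)
    have hp := JFSQ.super_waitProb_le hb hr hε hR hπ hA c₁ (by linarith) (by nlinarith)
    have hm := hpos 0
    have hb1 : (0 : ℝ) ≤ b - 1 := by linarith
    have hbound : 2 * b / ε * (48 * b * μ 0 / (ε ^ 2 * (N : ℝ) ^ (1 - α))) ≤
        JFSQ.kSuper b r ε (μ 0) * Real.log N / (N : ℝ) ^ (1 - α) :=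
      JFSQ.mul_le_kSuper_mul_div hb' hr hε hm.le hD0 c₃'
    have hone : 1 ≤ 2 * b / ε := by rw [le_div_iff₀ hε]; linarith
    have hp0 : 0 ≤ 48 * b * μ 0 / (ε ^ 2 * (N : ℝ) ^ (1 - α)) := by positivity
    -- The regime condition reads 24rb μ₁ log² N ≤ εD, and εr log² N ≥ 4 for large N, so 96b μ₁ ≤
    -- ε²D.
    have hhalf : JFSQ.waitProb μ π ≤ 1 / 2 := by
      refine hp.trans ?_
      have hf := hA.fastest
      rw [div_le_div_iff₀ hε (by positivity)] at hf
      rw [div_le_iff₀ (by positivity)]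
      have h1 : 8 * b * Real.log N ≤ ε * (r * Real.log N) * Real.log N :=
        mul_le_mul_of_nonneg_right c₃'' (by linarith)
      have h2 : 4 ≤ ε * (r * Real.log N ^ 2) := by nlinarith
      have h3 : 96 * b * μ 0 * 1 ≤ 24 * b * μ 0 * (ε * (r * Real.log N ^ 2)) := by
        nlinarith [mul_le_mul_of_nonneg_left h2 (by positivity : 0 ≤ 24 * b * μ 0)]
      nlinarith [mul_le_mul_of_nonneg_left hf hε.le]
    refine ⟨by linarith, JFSQ.integrable_waitLaw hpos π, ?_, ?_⟩
    · have hW := JFSQ.integral_waitLaw_le hε hR.lower hπ.nonneg (hB.trans hhalf)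
      have h1 := mul_le_mul_of_nonneg_left hp (by positivity : 0 ≤ 2 * b / ε)
      have h2 : 0 ≤ Real.log N / Real.sqrt N := by positivity
      linarith
    · have := mul_le_mul_of_nonneg_right hone hp0
      linarith
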